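/- **Setting.** Let $G=(V,E)$ be a finite undirected graph with source-sink pairs $(s_1,t_1),\dots,(s_r,t_r)$, let $k\ge 2$ be an integer, and let every node have cost $1$. A *terminal* is a node among $s_1,t_1,\dots,s_r,t_r$. Two nodes are *at least* (*less than*) *$c$-node-connected* in $(S,E(S))$ if the maximum number of pairwise internally node-disjoint simple paths between them with all nodes in $S$ is $\ge c$ ($<c$). A *feasible solution* of node-deletion $k$-route node-multicut is a set $A\subseteq V$ of non-terminals such that $(V\setminus A,E(V\setminus A))$ has at most $k-1$ node-disjoint $s_i$-$t_i$ paths for all $i$. The LP relaxation is: minimize $\sum_v x_v$ over $x,y^1,\dots,y^r\ge 0$ subject to $\sum_{v\in V(P)}(x_v+y^i_v)\ge 1$ for every $i$ and every simple $s_i$-$t_i$ path $P$; $\sum_v y^i_v\le k-1$ and $y^i_{s_i}=y^i_{t_i}=0$ for every $i$; $x_v=0$ for every terminal $v$. Let $(x,\{y^i\})$ be an optimal solution, $OPT=\sum_v x_v$ and $\beta=OPT/r$. **Region growing.** Let $\ell^i(u;v)$ be the minimum of $\sum_{w\in V(P),\,w\ne u}(x_w+y^i_w)$ over $u$-$v$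 paths $P$ ($+\infty$ if there is none). For $S\subseteq V$, a commodity $i$ and $\rho\ge 0$ let $B=\{v\in S:\ell^i(s_i;v)\le\rho\}$; let $\Gamma$ be the set of nodes of $S\setminus B$ with a neighbour in $B$; $\Gamma^x=\{v\in\Gamma:\rho+y^i_v<\ell^i(s_i;v)\le \rho+x_v+y^i_v\}$; $\Gamma^y=\{v\in\Gamma:\rho<\ell^i(s_i;v)\le\rho+y^i_v\}$; $\overline B=S\setminus(B\cup\Gamma)$; and $$\mathcal V(S)=\beta+\sum_{v\in S}x_v,\qquad \mathcal V=\beta+\sum_{v\in B\cup\Gamma^y}x_v+\sum_{v\in\Gamma^x}\bigl(\rho-(\ell^i(s_i;v)-x_v-y^i_v)\bigr),$$ $$\overline{\mathcal V}=\beta+\sum_{v\in\overline B\cup\Gamma^y}x_v+\sum_{v\in\Gamma^x}\bigl(\ell^i(s_i;v)-y^i_v-\rho\bigr).$$ For $\gamma>1$, call $\rho\in[0,1)$ *good* for $(S,i)$ if, for both $W=\mathcal V$ and $W=\overline{\mathcal V}$, $|\Gamma|\le\frac{2\gamma}{(\sqrt\gamma-1)^2}\,W\ln\bigl(\tfrac{e\,\mathcal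 V(S)}{W}\bigr)\ln\ln(e(r+1))$. **Algorithm ND-$k$-NMCAlg$(U,\mathcal T)$.** Start with $S=U$, $Z=\emptyset$, $\mathcal S=\emptyset$. While some pair of $\mathcal T$ is at least $\gamma(k-1)$-node-connected in $(S,E(S))$: pick such a pair $(s_i,t_i)$ and a good $\rho$ for $(S,i)$; let $A=B$ if $B\cup\Gamma^y$ contains at most $|\mathcal T|/2$ pairs of $\mathcal T$, and $A=\overline B$ otherwise; add $A$ to $\mathcal S$, add $\Gamma$ to $Z$, and replace $S$ by $S\setminus(A\cup\Gamma)$. When the loop ends, for every $A\in\mathcal S$ add to $Z$ the output of the algorithm on $A$ and the pairs of $\mathcal T$ with both ends in $A$. Return $Z$. The initial call is $(V,\{(s_1,t_1),\dots,(s_r,t_r)\})$. **Theorem.** There is an absolute constant $C>0$ such that, for every instance as above (with $k\ge2$) and every optimal solution $(x,\{y^i\})$ of the LP, the following holds, with $\Lambda(r)=\ln(\max\{r,3\})\cdot\ln\ln(\max\{r,3\})$. 1. For every $\gamma>1$: whenever $s_i,t_i$ are at least $\gamma(k-1)$-node-connected in $(S,E(S))$, $S\subseteq V$, there is a good radius for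 $(S,i)$, and the algorithm has an output. Whatever pairs and good radii are chosen, its output $Z$ satisfies $|Z|\le C\,\frac{\gamma}{(\sqrt\gamma-1)^2}\,\Lambda(r)\cdot OPT$, and every pair $s_i,t_i$ is less than $\gamma(k-1)$-node-connected in $(V\setminus Z,E(V\setminus Z))$. 2. For $\gamma=\frac{k}{k-1}$, every output $Z$ satisfies $|Z|\le C\,(k-1)^2\,\Lambda(r)\cdot OPT$, and $(V\setminus Z,E(V\setminus Z))$ has at most $k-1$ node-disjoint $s_i$-$t_i$ paths for all $i$. A terminal $v$ can belong to $Z$ only if $y^i_v>0$ for some $i$; so if all $y^i$ vanish on the terminals, $Z$ is a feasible solution. -/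

import Mathlib

universe u

/-- The data of a node-deletion `k`-route node-multicut instance with unit node costs on the
node set `V`: an undirected graph, `r` source-sink pairs, and the connectivity bound `k`. -/
structure NodeMulticut (V : Type u) where
  graph : SimpleGraph V
  r : ℕ
  s : Fin r → V
  t : Fin r → V
  k : ℕ

namespace NodeMulticut

variable {V : Type u} (I : NodeMulticut V)

/-- `v` is one of `s_1, t_1, …, s_r, t_r`. -/
def IsTerminal (v : V) : Prop := ∃ i, v = I.s i ∨ v = I.t i

/-- A finite set of pairwise (internally) node-disjoint simple `a`-`b` paths, all of whose nodes
lie in `S`, that is, paths of the induced subgraph `(S, E(S))`. -/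
def NodeDisjoint (S : Finset V) {a b : V} (P : Finset (I.graph.Path a b)) : Prop :=
  (∀ p ∈ P, ∀ w ∈ p.1.support, w ∈ S) ∧
  ∀ p ∈ P, ∀ q ∈ P, p ≠ q → ∀ w ∈ p.1.support, w ∈ q.1.support → w = a ∨ w = b

/-- `a` and `b` are at least `c`-node-connected in `(S, E(S))`. -/
def ConnAtLeast (S : Finset V) (a b : V) (c : ℝ) : Prop :=
  ∃ P : Finset (I.graph.Path a b), I.NodeDisjoint S P ∧ c ≤ (P.card : ℝ)

/-- `a` and `b` are less than `c`-node-connected in `(S, E(S))`. -/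
def ConnLess (S : Finset V) (a b : V) (c : ℝ) : Prop :=
  ∀ P : Finset (I.graph.Path a b), I.NodeDisjoint S P → (P.card : ℝ) < c

variable [Fintype V] [DecidableEq V]

/-- After deleting `Z`, there are at most `k - 1` node-disjoint `s_i`-`t_i` paths, for all `i`. -/
def MeetsConnectivity (Z : Finset V) : Prop :=
  ∀ i, ∀ P : Finset (I.graph.Path (I.s i) (I.t i)),
    I.NodeDisjoint (Finset.univ \ Z) P → P.card ≤ I.k - 1

/-- Feasible solutions of the problem: node sets without terminals whose deletion leaves at most
`k - 1` node-disjoint `s_i`-`t_i` paths for all `i`. -/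
def IsFeasible (Z : Finset V) : Prop :=
  (∀ v ∈ Z, ¬ I.IsTerminal v) ∧ I.MeetsConnectivity Z

/-- Feasible points `(x, {yⁱ})` of the linear programming relaxation. -/
structure LPFeasible (x : V → ℝ) (y : Fin I.r → V → ℝ) : Prop where
  x_nonneg : ∀ v, 0 ≤ x v
  y_nonneg : ∀ i v, 0 ≤ y i v
  path : ∀ i, ∀ p : I.graph.Path (I.s i) (I.t i),
    1 ≤ (p.1.support.map fun v => x v + y i v).sum
  budget : ∀ i, ∑ v, y i v ≤ (I.k : ℝ) - 1
  y_source : ∀ i, y i (I.s i) = 0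
  y_sink : ∀ i, y i (I.t i) = 0
  x_terminal : ∀ v, I.IsTerminal v → x v = 0

/-- Optimal solutions of the linear program, whose objective is `∑ v, x v` (unit costs). -/
def LPOptimal (x : V → ℝ) (y : Fin I.r → V → ℝ) : Prop :=
  I.LPFeasible x y ∧ ∀ x' y', I.LPFeasible x' y' → ∑ v, x v ≤ ∑ v, x' v

variable (x : V → ℝ) (y : Fin I.r → V → ℝ)

/-- `ℓⁱ(a; b)`: the minimum over `a`-`b` paths of the total `x + yⁱ` of all nodes other than the
first one. It is used only for `b` reachable from `a`. -/
noncomputable def ell (i : Fin I.r) (a b : V) : ℝ :=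
  ⨅ p : I.graph.Path a b, (p.1.support.tail.map fun w => x w + y i w).sum

open Classical in
/-- The ball `B^S_i(z, ρ)`. -/
noncomputable def ball (S : Finset V) (i : Fin I.r) (z : V) (ρ : ℝ) : Finset V :=
  S.filter fun v => I.graph.Reachable z v ∧ I.ell x y i z v ≤ ρ

open Classical in
/-- The boundary `Γ^S_i(z, ρ)`: the nodes of `S` outside the ball with a neighbour in the ball. -/
noncomputable def bdry (S : Finset V) (i : Fin I.r) (z : V) (ρ : ℝ) : Finset V :=
  (S \ I.ball x y S i z ρ).filter fun v => ∃ w ∈ I.ball x y S i z ρ, I.graph.Adj w v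

open Classical in
/-- The `x`-boundary: the boundary nodes with `ρ + yⁱ_v < ℓⁱ(z; v) ≤ ρ + x_v + yⁱ_v`. -/
noncomputable def xBdry (S : Finset V) (i : Fin I.r) (z : V) (ρ : ℝ) : Finset V :=
  (I.bdry x y S i z ρ).filter fun v =>
    ρ + y i v < I.ell x y i z v ∧ I.ell x y i z v ≤ ρ + x v + y i v

open Classical in
/-- The `y`-boundary: the boundary nodes with `ρ < ℓⁱ(z; v) ≤ ρ + yⁱ_v`. -/
noncomputable def yBdry (S : Finset V) (i : Fin I.r) (z : V) (ρ : ℝ) : Finset V :=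
  (I.bdry x y S i z ρ).filter fun v =>
    ρ < I.ell x y i z v ∧ I.ell x y i z v ≤ ρ + y i v

/-- The rest of `S`, outside the ball and its boundary. -/
noncomputable def coBall (S : Finset V) (i : Fin I.r) (z : V) (ρ : ℝ) : Finset V :=
  S \ (I.ball x y S i z ρ ∪ I.bdry x y S i z ρ)

/-- `β = OPT / r`, where `OPT = ∑ v, x v`. -/
noncomputable def beta : ℝ := (∑ v, x v) / (I.r : ℝ)

/-- The volume of the region `S`. -/
noncomputable def regionVol (S : Finset V) : ℝ := I.beta x + ∑ v ∈ S, x v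

/-- The volume of the ball. -/
noncomputable def ballVol (S : Finset V) (i : Fin I.r) (z : V) (ρ : ℝ) : ℝ :=
  I.beta x + ∑ v ∈ I.ball x y S i z ρ ∪ I.yBdry x y S i z ρ, x v
    + ∑ v ∈ I.xBdry x y S i z ρ, (ρ - (I.ell x y i z v - x v - y i v))

/-- The volume of the complement of the ball. -/
noncomputable def coBallVol (S : Finset V) (i : Fin I.r) (z : V) (ρ : ℝ) : ℝ :=
  I.beta x + ∑ v ∈ I.coBall x y S i z ρ ∪ I.yBdry x y S i z ρ, x v
    + ∑ v ∈ I.xBdry x y S i z ρ, (I.ell x y i z v - y i v - ρ)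

/-- The radii that the region-growing step of the algorithm may use: the size of the boundary is
bounded in terms of both volumes. -/
def GoodRadius (γ : ℝ) (S : Finset V) (i : Fin I.r) (ρ : ℝ) : Prop :=
  0 ≤ ρ ∧ ρ < 1 ∧
  ((I.bdry x y S i (I.s i) ρ).card : ℝ) ≤
    2 * γ / (√γ - 1) ^ 2 * I.ballVol x y S i (I.s i) ρ
      * Real.log (Real.exp 1 * I.regionVol x S / I.ballVol x y S i (I.s i) ρ)
      * Real.log (Real.log (Real.exp 1 * ((I.r : ℝ) + 1))) ∧
  ((I.bdry x y S i (I.s i) ρ).card : ℝ) ≤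
    2 * γ / (√γ - 1) ^ 2 * I.coBallVol x y S i (I.s i) ρ
      * Real.log (Real.exp 1 * I.regionVol x S / I.coBallVol x y S i (I.s i) ρ)
      * Real.log (Real.log (Real.exp 1 * ((I.r : ℝ) + 1)))

/-- The pairs of `T` with both ends in `A`. -/
def pairsIn (T : Finset (Fin I.r)) (A : Finset V) : Finset (Fin I.r) :=
  T.filter fun i => I.s i ∈ A ∧ I.t i ∈ A

/-- The carved-out set: the ball if the ball together with the `y`-boundary contains at most
half of the pairs of `T`, and the complement otherwise. -/
noncomputable def carve (T : Finset (Fin I.r)) (S : Finset V) (i : Fin I.r) (ρ : ℝ) : Finset V :=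
  if 2 * (I.pairsIn T (I.ball x y S i (I.s i) ρ ∪ I.yBdry x y S i (I.s i) ρ)).card ≤ T.card
  then I.ball x y S i (I.s i) ρ else I.coBall x y S i (I.s i) ρ

/-- The states `(S, 𝒮, Z)` that the while loop of the call with arguments `(U, T)` can reach: `S`
is the current region, `𝒮` the collection of carved-out sets, `Z` the set of deleted nodes. An
iteration picks a pair of `T` that is still at least `γ(k-1)`-node-connected in `S` and a good
radius, deletes the boundary and carves out one side. -/
inductive LoopReaches (γ : ℝ) (U : Finset V) (T : Finset (Fin I.r)) :
    Finset V → Finset (Finset V) → Finset V → Prop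
  | start : LoopReaches γ U T U ∅ ∅
  | step (S : Finset V) (C : Finset (Finset V)) (Z : Finset V) (i : Fin I.r) (ρ : ℝ) :
      LoopReaches γ U T S C Z → i ∈ T →
      I.ConnAtLeast S (I.s i) (I.t i) (γ * ((I.k : ℝ) - 1)) →
      I.GoodRadius x y γ S i ρ →
      LoopReaches γ U T (S \ (I.carve x y T S i ρ ∪ I.bdry x y S i (I.s i) ρ))
        (insert (I.carve x y T S i ρ) C) (Z ∪ I.bdry x y S i (I.s i) ρ)

/-- `Returns γ U T Z`: the recursive algorithm, called with the node set `U` and the pairs `T`,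
can return `Z` (for some choice of pairs and radii). The loop runs until no pair of `T` is at least
`γ(k-1)`-node-connected in the region; then the algorithm is called on every carved-out set `A`,
with the pairs of `T` inside `A`. -/
inductive Returns (γ : ℝ) : Finset V → Finset (Fin I.r) → Finset V → Prop
  | intro (U : Finset V) (T : Finset (Fin I.r)) (S : Finset V) (C : Finset (Finset V))
      (Z : Finset V) (Zrec : Finset V → Finset V) :
      I.LoopReaches x y γ U T S C Z →
      (∀ i ∈ T, ¬ I.ConnAtLeast S (I.s i) (I.t i) (γ * ((I.k : ℝ) - 1))) →
      (∀ A ∈ C, Returns γ A (I.pairsIn T A) (Zrec A)) →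
      Returns γ U T (Z ∪ C.biUnion Zrec)

end NodeMulticut

/-- `ln r · ln ln r`, with `r` replaced by `3` for `r ≤ 2`, where `ln ln r` is not positive. -/
noncomputable def lnTimesLnLn (r : ℕ) : ℝ :=
  Real.log (max (r : ℝ) 3) * Real.log (Real.log (max (r : ℝ) 3))

/-! Write `L` for `ln ln(e(r+1))`. A radius is good unless it lies in one of three exceptional
subsets of `[0,1)`, whose measures add up to less than 1. (a) The nodes of `Γ^y` are those whose
interval `[ℓ-y, ℓ)` contains `ρ`; these intervals have total length at most `k-1`, so `|Γ^y| >
√γ(k-1)` happens only on measure less than `1/√γ` (`volume_large_yBdry_lt`). Elsewhere `|Γ| ≥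
γ(k-1)`, because disjoint paths cross `Γ` at distinct nodes, so `Γ^x` makes up at least the fraction
`1-1/√γ` of `Γ`. (b), (c) The ball volume `W` grows at rate at least `|Γ^x|`, and `-ln ln(eM/W)` has
derivative `W'/(W ln(eM/W))` and total increase at most `L`; hence `|Γ^x|` exceeds `c W ln(eM/W)`
only on measure `L/c`. The same holds for the complementary volume. Choosing `c` so that (b) and (c)
together take at most `1-1/√γ` gives `exists_goodRadius`.

The cost is bounded by a potential: a call on `(U,T)` is given `x(U) + β|T|` units of volume, each
worth `1 + ln(Vol(U)/β) + 2 ln|T|`. An iteration with volume `W` spends `1 + ln(Vol(U)/W)` per unit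
on its boundary. The carved-out set has volume at most `W` and at most half of the pairs, so its own
call costs at most `ln(W/β) + 2 ln|T|` per unit, and the two prices add up exactly
(`iteration_cost_le`). The term `β` inside `W` is charged to the pair that the iteration separates.
At the top level the volume is `2·OPT` and the price is `O(ln r)`.

Connectivity holds because, after deletion, no edge leaves any carved-out set or the final region
(`LoopReaches.separated`), so all surviving paths of a pair lie in one of them. -/

set_option linter.unusedSectionVars false

/-! ### Measure of the exceptional radii -/

open MeasureTheory Filter Topology

/-- Markov's inequality for `deriv g`. A monotone function may jump, but the integral of its
derivative is still at most its increase, and only this direction is needed. -/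
theorem volume_le_of_monotone_of_le_deriv {g : ℝ → ℝ} (hg : Monotone g) {c : ℝ} (hc : 0 < c)
    {F : Set ℝ} (hF : F ⊆ Set.Ico 0 1) (h : ∀ᵐ ρ, ρ ∈ F → c ≤ deriv g ρ) :
    volume F ≤ ENNReal.ofReal ((g 1 - g 0) / c) := by
  have hmono : MonotoneOn g (Set.uIcc 0 1) := hg.monotoneOn _
  have hint : ∫ ρ in (0 : ℝ)..1, deriv g ρ ≤ g 1 - g 0 := by
    have := hmono.intervalIntegral_deriv_mem_uIcc
    rw [Set.uIcc_of_le (sub_nonneg.2 (hg zero_le_one))] at this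
    exact this.2
  have hi : IntegrableOn (deriv g) (Set.Ioc 0 1) :=
    (intervalIntegrable_iff_integrableOn_Ioc_of_le zero_le_one).1 hmono.intervalIntegrable_deriv
  rw [intervalIntegral.integral_of_le zero_le_one] at hint
  have hmarkov := mul_meas_ge_le_integral_of_nonneg (μ := volume.restrict (Set.Ioc (0 : ℝ) 1))
    (Eventually.of_forall fun ρ => hg.deriv_nonneg (x := ρ)) hi c
  have hm : MeasurableSet {ρ | c ≤ deriv g ρ} :=
    measurableSet_le measurable_const (measurable_deriv g)
  have hle : volume F ≤ volume.restrict (Set.Ioc (0 : ℝ) 1) {ρ | c ≤ deriv g ρ} := by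
    rw [Measure.restrict_apply hm]
    have h0 : ∀ᵐ ρ : ℝ, ρ ≠ 0 := by simp [ae_iff]
    refine measure_mono_ae ?_
    filter_upwards [h, h0] with ρ hρ h0 hmem
    exact ⟨hρ hmem, lt_of_le_of_ne (hF hmem).1 (Ne.symm h0), (hF hmem).2.le⟩
  refine hle.trans ?_
  rw [← ENNReal.ofReal_toReal (measure_ne_top (volume.restrict (Set.Ioc (0 : ℝ) 1)) _)]
  apply ENNReal.ofReal_le_ofReal
  rw [le_div_iff₀ hc, mul_comm]
  exact hmarkov.trans hint

/-- This is the purpose of the factor `e`: it makes the iterated logarithm nonnegative. -/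
theorem one_le_log_exp_mul_div {W M : ℝ} (hW : 0 < W) (hWM : W ≤ M) :
    1 ≤ Real.log (Real.exp 1 * M / W) := by
  rw [Real.le_log_iff_exp_le (by have := hW.trans_le hWM; positivity), mul_div_assoc]
  exact le_mul_of_one_le_right (Real.exp_pos 1).le ((one_le_div hW).2 hWM)

theorem log_exp_mul_div_eq {W M : ℝ} (hW : 0 < W) (hM : 0 < M) :
    Real.log (Real.exp 1 * M / W) = 1 + Real.log M - Real.log W := by
  rw [Real.log_div (by positivity) hW.ne', Real.log_mul (Real.exp_pos 1).ne' hM.ne', Real.log_exp]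

/-- The function `W ↦ W ln(eM/W)` is nondecreasing on `(0, M]`. -/
theorem mul_log_exp_mul_div_mono {W W' M : ℝ} (hW : 0 < W) (h : W ≤ W') (hM : W' ≤ M) :
    W * Real.log (Real.exp 1 * M / W) ≤ W' * Real.log (Real.exp 1 * M / W') := by
  have hW' := hW.trans_le h
  have hM0 := hW'.trans_le hM
  rw [log_exp_mul_div_eq hW hM0, log_exp_mul_div_eq hW' hM0]
  have h1 : Real.log W' ≤ Real.log M := Real.log_le_log hW' hM
  have h2 : W * (Real.log W' - Real.log W) ≤ W' - W := by
    rw [← Real.log_div hW'.ne' hW.ne']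
    have := Real.log_le_sub_one_of_pos (div_pos hW' hW)
    calc W * Real.log (W' / W) ≤ W * (W' / W - 1) := by gcongr
      _ = W' - W := by field_simp
  nlinarith [mul_nonneg (sub_nonneg.2 h) (sub_nonneg.2 h1)]

theorem log_log_exp_mul_div_anti {W W' M : ℝ} (hW : 0 < W) (h : W ≤ W') (hM : W' ≤ M) :
    Real.log (Real.log (Real.exp 1 * M / W')) ≤ Real.log (Real.log (Real.exp 1 * M / W)) := by
  have hW' := hW.trans_le h
  have := hW'.trans_le hM
  refine Real.log_le_log (zero_lt_one.trans_le (one_le_log_exp_mul_div hW' hM)) ?_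
  refine Real.log_le_log (by positivity) ?_
  gcongr

/-- The sign `ε` treats growing and shrinking volumes together. The monotone function `-ε ln
ln(eM/W)` has derivative `εW'/(W ln(eM/W))`, which exceeds `c` on the set in question, while its
values stay in an interval of length `ln ln(eM/b)`. -/
theorem volume_fast_growth_le_aux {W n : ℝ → ℝ} {b M c ε : ℝ} (hb : 0 < b) (hc : 0 < c)
    (hε : |ε| = 1) (hW : ∀ ρ, b ≤ W ρ) (hWM : ∀ ρ, W ρ ≤ M)
    (hg : Monotone fun ρ => -ε * Real.log (Real.log (Real.exp 1 * M / W ρ)))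
    (hd : ∀ᵐ ρ, DifferentiableAt ℝ W ρ ∧ n ρ ≤ ε * deriv W ρ) :
    volume {ρ ∈ Set.Ico (0 : ℝ) 1 | c * (W ρ * Real.log (Real.exp 1 * M / W ρ)) < n ρ} ≤
      ENNReal.ofReal (Real.log (Real.log (Real.exp 1 * M / b)) / c) := by
  have hM : 0 < M := hb.trans_le ((hW 0).trans (hWM 0))
  refine (volume_le_of_monotone_of_le_deriv hg hc (fun ρ hρ => hρ.1) ?_).trans ?_
  · filter_upwards [hd] with ρ ⟨hdiff, hn⟩ hρ
    have hWp : 0 < W ρ := hb.trans_le (hW ρ)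
    have hL := zero_lt_one.trans_le (one_le_log_exp_mul_div hWp (hWM ρ))
    have hder : HasDerivAt (fun ρ => -ε * Real.log (Real.log (Real.exp 1 * M / W ρ)))
        (ε * deriv W ρ / (W ρ * Real.log (Real.exp 1 * M / W ρ))) ρ := by
      have heq : (fun ρ => -ε * Real.log (Real.log (Real.exp 1 * M / W ρ))) =
          fun ρ => -ε * Real.log (1 + Real.log M - Real.log (W ρ)) := by
        funext ρ
        rw [log_exp_mul_div_eq (hb.trans_le (hW ρ)) hM]
      rw [heq]
      rw [log_exp_mul_div_eq hWp hM] at hL ⊢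
      have h1 := ((hdiff.hasDerivAt.log hWp.ne').const_sub (1 + Real.log M)).log hL.ne'
      refine (h1.const_mul (-ε)).congr_deriv ?_
      field_simp
    rw [hder.deriv, le_div_iff₀ (by positivity)]
    exact hρ.2.le.trans hn
  · apply ENNReal.ofReal_le_ofReal
    gcongr
    have key : ∀ ρ, 0 ≤ Real.log (Real.log (Real.exp 1 * M / W ρ)) ∧
        Real.log (Real.log (Real.exp 1 * M / W ρ)) ≤ Real.log (Real.log (Real.exp 1 * M / b)) :=
      fun ρ => ⟨Real.log_nonneg (one_le_log_exp_mul_div (hb.trans_le (hW ρ)) (hWM ρ)),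
        log_log_exp_mul_div_anti hb (hW ρ) (hWM ρ)⟩
    have h0 := key 0
    have h1 := key 1
    rcases eq_or_eq_neg_of_abs_eq hε with rfl | rfl <;> linarith

/-- Right slopes suffice once differentiability is known, and monotonicity supplies that almost
everywhere. -/
theorem le_deriv_of_eventually_right {W : ℝ → ℝ} {a ρ : ℝ} (hd : DifferentiableAt ℝ W ρ)
    (h : ∀ᶠ ρ' in 𝓝[>] ρ, W ρ + a * (ρ' - ρ) ≤ W ρ') : a ≤ deriv W ρ := by
  have ht : Tendsto (slope W ρ) (𝓝[>] ρ) (𝓝 (deriv W ρ)) :=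
    (hasDerivAt_iff_tendsto_slope.1 hd.hasDerivAt).mono_left
      (nhdsWithin_mono _ fun z (hz : ρ < z) => hz.ne')
  refine ge_of_tendsto ht ?_
  filter_upwards [h, self_mem_nhdsWithin] with z hz (hlt : ρ < z)
  rw [slope_def_field, le_div_iff₀ (sub_pos.2 hlt)]
  linarith

/-- If the volume `W` grows at rate at least `n`, then the radii at which `n` exceeds
`c W ln(eM/W)` have measure at most `ln ln(eM/b) / c`. -/
theorem volume_fast_growth_le {W n : ℝ → ℝ} {b M c : ℝ} (hb : 0 < b) (hc : 0 < c)
    (hW : ∀ ρ, b ≤ W ρ) (hWM : ∀ ρ, W ρ ≤ M) (hmono : Monotone W)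
    (hn : ∀ ρ, ∀ᶠ ρ' in 𝓝[>] ρ, W ρ + n ρ * (ρ' - ρ) ≤ W ρ') :
    volume {ρ ∈ Set.Ico (0 : ℝ) 1 | c * (W ρ * Real.log (Real.exp 1 * M / W ρ)) < n ρ} ≤
      ENNReal.ofReal (Real.log (Real.log (Real.exp 1 * M / b)) / c) := by
  refine volume_fast_growth_le_aux (ε := 1) hb hc (by simp) hW hWM ?_ ?_
  · intro ρ ρ' h
    have := log_log_exp_mul_div_anti (hb.trans_le (hW ρ)) (hmono h) (hWM ρ')
    simpa using this
  · filter_upwards [hmono.ae_differentiableAt] with ρ hρ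
    exact ⟨hρ, by rw [one_mul]; exact le_deriv_of_eventually_right hρ (hn ρ)⟩

theorem volume_fast_decay_le {W n : ℝ → ℝ} {b M c : ℝ} (hb : 0 < b) (hc : 0 < c)
    (hW : ∀ ρ, b ≤ W ρ) (hWM : ∀ ρ, W ρ ≤ M) (hanti : Antitone W)
    (hn : ∀ ρ, ∀ᶠ ρ' in 𝓝[>] ρ, W ρ' ≤ W ρ - n ρ * (ρ' - ρ)) :
    volume {ρ ∈ Set.Ico (0 : ℝ) 1 | c * (W ρ * Real.log (Real.exp 1 * M / W ρ)) < n ρ} ≤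
      ENNReal.ofReal (Real.log (Real.log (Real.exp 1 * M / b)) / c) := by
  refine volume_fast_growth_le_aux (ε := -1) hb hc (by simp) hW hWM ?_ ?_
  · intro ρ ρ' h
    have := log_log_exp_mul_div_anti (hb.trans_le (hW ρ')) (hanti h) (hWM ρ)
    simpa using this
  · filter_upwards [hanti.neg.ae_differentiableAt] with ρ hρ
    have hd : DifferentiableAt ℝ W ρ := by simpa using hρ.neg
    refine ⟨hd, ?_⟩
    have := le_deriv_of_eventually_right (W := -W) (a := n ρ) hρ
      ((hn ρ).mono fun z hz => by simp only [Pi.neg_apply]; linarith)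
    rw [deriv.neg] at this
    linarith

/-- A family of half-open intervals `[ℓ_v - y_v, ℓ_v)` of total length `∑ y_v` covers the points of
multiplicity at least `q` only on a set of measure `∑ y_v / q`. -/
theorem volume_multiplicity_ge_le {V : Type*} [Fintype V] (l y : V → ℝ) (hy : ∀ v, 0 ≤ y v)
    {q : ℕ} (hq : 0 < q) :
    volume {ρ : ℝ | q ≤ (Finset.univ.filter fun v => ρ < l v ∧ l v ≤ ρ + y v).card} ≤
      ENNReal.ofReal ((∑ v, y v) / q) := by
  classical
  -- The multiplicity function; its integral is the total length, and Markov's inequality at level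
  -- `q` concludes.
  let N : ℝ → ENNReal := fun ρ => ∑ v, (Set.Ico (l v - y v) (l v)).indicator 1 ρ
  have hN : Measurable N := by
    refine Finset.measurable_sum _ fun v _ => ?_
    exact measurable_one.indicator measurableSet_Ico
  have hNeq : ∀ ρ : ℝ, N ρ = (Finset.univ.filter fun v => ρ < l v ∧ l v ≤ ρ + y v).card := by
    intro ρ
    simp only [N, Finset.card_filter, Nat.cast_sum, Set.indicator_apply, Set.mem_Ico,
      Pi.one_apply, Nat.cast_ite, Nat.cast_one, Nat.cast_zero]
    refine Finset.sum_congr rfl fun v _ => ?_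
    congr 1
    rw [sub_le_iff_le_add, and_comm]
  have hint : ∫⁻ ρ, N ρ = ENNReal.ofReal (∑ v, y v) := by
    simp only [N]
    rw [lintegral_finsetSum _ fun v _ => measurable_one.indicator measurableSet_Ico,
      ENNReal.ofReal_sum_of_nonneg fun v _ => hy v]
    refine Finset.sum_congr rfl fun v _ => ?_
    rw [lintegral_indicator_one measurableSet_Ico, Real.volume_Ico]
    congr 1
    ring
  have h := mul_meas_ge_le_lintegral (μ := volume) hN q
  rw [hint] at h
  have hset : {ρ : ℝ | q ≤ (Finset.univ.filter fun v => ρ < l v ∧ l v ≤ ρ + y v).card} =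
      {ρ | (q : ENNReal) ≤ N ρ} := by
    ext ρ
    simp [hNeq]
  rw [hset, ENNReal.ofReal_div_of_pos (by exact_mod_cast hq), ENNReal.ofReal_natCast]
  rw [ENNReal.le_div_iff_mul_le (by simp [hq.ne']) (by simp), mul_comm]
  exact h

namespace NodeMulticut

/-! ### The node-weighted distance -/

section Distance

variable {V : Type u} {I : NodeMulticut V} [Fintype V] [DecidableEq V]
  {x : V → ℝ} {y : Fin I.r → V → ℝ} {i : Fin I.r}

theorem weight_list_nonneg (hx : ∀ v, 0 ≤ x v) (hy : ∀ i v, 0 ≤ y i v) (l : List V) :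
    0 ≤ (l.map fun w => x w + y i w).sum := by
  refine List.sum_nonneg fun a ha => ?_
  obtain ⟨w, -, rfl⟩ := List.mem_map.1 ha
  exact add_nonneg (hx w) (hy i w)

theorem ell_le_path (hx : ∀ v, 0 ≤ x v) (hy : ∀ i v, 0 ≤ y i v) {a b : V}
    (p : I.graph.Path a b) :
    I.ell x y i a b ≤ (p.1.support.tail.map fun w => x w + y i w).sum :=
  ciInf_le ⟨0, by rintro _ ⟨q, rfl⟩; exact weight_list_nonneg hx hy _⟩ p

/-- Shortcutting a walk to a path only drops nonnegative weights. Walks are needed since a path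
extended by an edge may revisit a node. -/
theorem ell_le_walk (hx : ∀ v, 0 ≤ x v) (hy : ∀ i v, 0 ≤ y i v) {a b : V}
    (p : I.graph.Walk a b) :
    I.ell x y i a b ≤ (p.support.tail.map fun w => x w + y i w).sum := by
  refine (ell_le_path hx hy p.toPath).trans ?_
  have hsub : p.bypass.support.tail.Sublist p.support.tail := by
    have h := p.support_bypass_sublist_support
    rw [← p.cons_tail_support, ← p.bypass.cons_tail_support] at h
    exact List.cons_sublist_cons.1 h
  refine List.Sublist.sum_le_sum (hsub.map _) fun c hc => ?_
  obtain ⟨w, -, rfl⟩ := List.mem_map.1 hc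
  exact add_nonneg (hx w) (hy i w)

theorem ell_self (hx : ∀ v, 0 ≤ x v) (hy : ∀ i v, 0 ≤ y i v) (a : V) :
    I.ell x y i a a ≤ 0 := by
  simpa using ell_le_walk hx hy (SimpleGraph.Walk.nil : I.graph.Walk a a)

theorem ell_le_of_adj (hx : ∀ v, 0 ≤ x v) (hy : ∀ i v, 0 ≤ y i v) {a w v : V}
    (hr : I.graph.Reachable a w) (h : I.graph.Adj w v) :
    I.ell x y i a v ≤ I.ell x y i a w + (x v + y i v) := by
  rw [← sub_le_iff_le_add]
  have : Nonempty (I.graph.Path a w) := ⟨hr.some.toPath⟩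
  refine le_ciInf fun p => ?_
  rw [sub_le_iff_le_add]
  refine (ell_le_walk hx hy (p.1.concat h)).trans (le_of_eq ?_)
  rw [SimpleGraph.Walk.support_concat, List.tail_append_of_ne_nil p.1.support_ne_nil]
  simp

theorem LPFeasible.one_le_ell (h : I.LPFeasible x y)
    (hr : I.graph.Reachable (I.s i) (I.t i)) : 1 ≤ I.ell x y i (I.s i) (I.t i) := by
  have : Nonempty (I.graph.Path (I.s i) (I.t i)) := ⟨hr.some.toPath⟩
  refine le_ciInf fun p => ?_
  have h1 := h.path i p
  rw [← p.1.cons_tail_support, List.map_cons, List.sum_cons,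
    h.x_terminal _ ⟨i, Or.inl rfl⟩, h.y_source i] at h1
  linarith

end Distance

/-! ### Balls, boundaries and volumes -/

section Region

variable {V : Type u} {I : NodeMulticut V} [Fintype V] [DecidableEq V]
  {x : V → ℝ} {y : Fin I.r → V → ℝ} {S : Finset V} {i : Fin I.r} {z v : V} {ρ ρ' : ℝ}

theorem mem_ball : v ∈ I.ball x y S i z ρ ↔
    v ∈ S ∧ I.graph.Reachable z v ∧ I.ell x y i z v ≤ ρ := by
  simp [ball]

theorem mem_bdry : v ∈ I.bdry x y S i z ρ ↔
    (v ∈ S ∧ v ∉ I.ball x y S i z ρ) ∧ ∃ w ∈ I.ball x y S i z ρ, I.graph.Adj w v := by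
  simp [bdry]

theorem mem_coBall : v ∈ I.coBall x y S i z ρ ↔
    v ∈ S ∧ v ∉ I.ball x y S i z ρ ∧ v ∉ I.bdry x y S i z ρ := by
  simp [coBall]

theorem mem_xBdry : v ∈ I.xBdry x y S i z ρ ↔ v ∈ I.bdry x y S i z ρ ∧
    ρ + y i v < I.ell x y i z v ∧ I.ell x y i z v ≤ ρ + x v + y i v := by
  simp [xBdry]

theorem mem_yBdry : v ∈ I.yBdry x y S i z ρ ↔ v ∈ I.bdry x y S i z ρ ∧
    ρ < I.ell x y i z v ∧ I.ell x y i z v ≤ ρ + y i v := by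
  simp [yBdry]

theorem ball_mono (h : ρ ≤ ρ') : I.ball x y S i z ρ ⊆ I.ball x y S i z ρ' := by
  intro v hv
  rw [mem_ball] at hv ⊢
  exact ⟨hv.1, hv.2.1, hv.2.2.trans h⟩

theorem ball_subset : I.ball x y S i z ρ ⊆ S := fun _ hv => (mem_ball.1 hv).1

theorem bdry_subset : I.bdry x y S i z ρ ⊆ S := fun _ hv => (mem_bdry.1 hv).1.1

theorem coBall_subset : I.coBall x y S i z ρ ⊆ S := fun _ hv => (mem_coBall.1 hv).1

theorem xBdry_subset : I.xBdry x y S i z ρ ⊆ I.bdry x y S i z ρ := fun _ hv => (mem_xBdry.1 hv).1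

theorem yBdry_subset : I.yBdry x y S i z ρ ⊆ I.bdry x y S i z ρ := fun _ hv => (mem_yBdry.1 hv).1

theorem disjoint_ball_bdry : Disjoint (I.ball x y S i z ρ) (I.bdry x y S i z ρ) :=
  Finset.disjoint_left.2 fun _ hv h => (mem_bdry.1 h).1.2 hv

theorem disjoint_coBall_ball : Disjoint (I.coBall x y S i z ρ) (I.ball x y S i z ρ) :=
  Finset.disjoint_left.2 fun _ hv h => (mem_coBall.1 hv).2.1 h

theorem disjoint_coBall_bdry : Disjoint (I.coBall x y S i z ρ) (I.bdry x y S i z ρ) :=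
  Finset.disjoint_left.2 fun _ hv h => (mem_coBall.1 hv).2.2 h

theorem disjoint_xBdry_yBdry : Disjoint (I.xBdry x y S i z ρ) (I.yBdry x y S i z ρ) :=
  Finset.disjoint_left.2 fun _ hv h => (mem_xBdry.1 hv).2.1.not_ge (mem_yBdry.1 h).2.2

/-- A boundary node may enter the ball as the radius grows, but never returns to the outside. This
makes `absorbed` monotone. -/
theorem near_mono (h : ρ ≤ ρ') : I.ball x y S i z ρ ∪ I.bdry x y S i z ρ ⊆
    I.ball x y S i z ρ' ∪ I.bdry x y S i z ρ' := by
  intro v hv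
  rw [Finset.mem_union] at hv ⊢
  rcases hv with hv | hv
  · exact Or.inl (ball_mono h hv)
  · by_cases hb : v ∈ I.ball x y S i z ρ'
    · exact Or.inl hb
    · obtain ⟨⟨hS, -⟩, w, hw, hadj⟩ := mem_bdry.1 hv
      exact Or.inr (mem_bdry.2 ⟨⟨hS, hb⟩, w, ball_mono h hw, hadj⟩)

theorem lt_ell_of_mem_bdry (hv : v ∈ I.bdry x y S i z ρ) : ρ < I.ell x y i z v := by
  obtain ⟨⟨hS, hb⟩, w, hw, hadj⟩ := mem_bdry.1 hv
  by_contra h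
  exact hb (mem_ball.2 ⟨hS, (mem_ball.1 hw).2.1.trans hadj.reachable, not_lt.1 h⟩)

theorem ell_le_of_mem_bdry (hx : ∀ v, 0 ≤ x v) (hy : ∀ i v, 0 ≤ y i v)
    (hv : v ∈ I.bdry x y S i z ρ) : I.ell x y i z v ≤ ρ + x v + y i v := by
  obtain ⟨-, w, hw, hadj⟩ := mem_bdry.1 hv
  rw [mem_ball] at hw
  linarith [ell_le_of_adj (i := i) hx hy hw.2.1 hadj, hw.2.2]

theorem bdry_eq_union (hx : ∀ v, 0 ≤ x v) (hy : ∀ i v, 0 ≤ y i v) :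
    I.bdry x y S i z ρ = I.xBdry x y S i z ρ ∪ I.yBdry x y S i z ρ := by
  ext v
  rw [Finset.mem_union, mem_xBdry, mem_yBdry]
  refine ⟨fun hv => ?_, fun hv => hv.elim And.left And.left⟩
  rcases lt_or_ge (ρ + y i v) (I.ell x y i z v) with h | h
  · exact Or.inl ⟨hv, h, ell_le_of_mem_bdry hx hy hv⟩
  · exact Or.inr ⟨hv, lt_ell_of_mem_bdry hv, h⟩

theorem card_bdry (hx : ∀ v, 0 ≤ x v) (hy : ∀ i v, 0 ≤ y i v) :
    (I.bdry x y S i z ρ).card = (I.xBdry x y S i z ρ).card + (I.yBdry x y S i z ρ).card := by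
  rw [bdry_eq_union hx hy, Finset.card_union_of_disjoint disjoint_xBdry_yBdry]

theorem sum_region (hx : ∀ v, 0 ≤ x v) (hy : ∀ i v, 0 ≤ y i v) (f : V → ℝ) :
    ∑ v ∈ S, f v = ∑ v ∈ I.ball x y S i z ρ, f v + ∑ v ∈ I.xBdry x y S i z ρ, f v
      + ∑ v ∈ I.yBdry x y S i z ρ, f v + ∑ v ∈ I.coBall x y S i z ρ, f v := by
  have h1 : I.ball x y S i z ρ ∪ I.bdry x y S i z ρ ⊆ S :=
    Finset.union_subset ball_subset bdry_subset
  rw [← Finset.sum_sdiff h1, Finset.sum_union disjoint_ball_bdry, bdry_eq_union hx hy,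
    Finset.sum_union disjoint_xBdry_yBdry, coBall, bdry_eq_union hx hy]
  ring

theorem ballVol_eq : I.ballVol x y S i z ρ = I.beta x + ∑ v ∈ I.ball x y S i z ρ, x v
    + ∑ v ∈ I.yBdry x y S i z ρ, x v
    + ∑ v ∈ I.xBdry x y S i z ρ, (ρ - (I.ell x y i z v - x v - y i v)) := by
  rw [ballVol, Finset.sum_union (disjoint_ball_bdry.mono_right yBdry_subset)]
  ring

theorem coBallVol_eq : I.coBallVol x y S i z ρ = I.beta x + ∑ v ∈ I.coBall x y S i z ρ, x v
    + ∑ v ∈ I.yBdry x y S i z ρ, x v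
    + ∑ v ∈ I.xBdry x y S i z ρ, (I.ell x y i z v - y i v - ρ) := by
  rw [coBallVol, Finset.sum_union (disjoint_coBall_bdry.mono_right yBdry_subset)]
  ring

/-- Each node of `Γ^x` splits its weight between the two sides, whereas `β` and the nodes of `Γ^y`
are counted on both. -/
theorem ballVol_add_coBallVol (hx : ∀ v, 0 ≤ x v) (hy : ∀ i v, 0 ≤ y i v) :
    I.ballVol x y S i z ρ + I.coBallVol x y S i z ρ =
      I.beta x + I.regionVol x S + ∑ v ∈ I.yBdry x y S i z ρ, x v := by
  have h : ∑ v ∈ I.xBdry x y S i z ρ, x v =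
      ∑ v ∈ I.xBdry x y S i z ρ, (ρ - (I.ell x y i z v - x v - y i v)) +
        ∑ v ∈ I.xBdry x y S i z ρ, (I.ell x y i z v - y i v - ρ) := by
    rw [← Finset.sum_add_distrib]
    exact Finset.sum_congr rfl fun v _ => by ring
  rw [ballVol_eq, coBallVol_eq, regionVol, sum_region (S := S) (i := i) (z := z) (ρ := ρ) hx hy, h]
  ring

theorem coBallVol_add_sum_ball_le (hx : ∀ v, 0 ≤ x v) (hy : ∀ i v, 0 ≤ y i v) :
    I.coBallVol x y S i z ρ + ∑ v ∈ I.ball x y S i z ρ, x v ≤ I.regionVol x S := by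
  have h : ∑ v ∈ I.xBdry x y S i z ρ, (I.ell x y i z v - y i v - ρ) ≤
      ∑ v ∈ I.xBdry x y S i z ρ, x v :=
    Finset.sum_le_sum fun v hv => by linarith [(mem_xBdry.1 hv).2.2]
  rw [coBallVol_eq, regionVol, sum_region (S := S) (i := i) (z := z) (ρ := ρ) hx hy]
  linarith

theorem ballVol_add_sum_coBall_le (hx : ∀ v, 0 ≤ x v) (hy : ∀ i v, 0 ≤ y i v) :
    I.ballVol x y S i z ρ + ∑ v ∈ I.coBall x y S i z ρ, x v ≤ I.regionVol x S := by
  have h : ∑ v ∈ I.xBdry x y S i z ρ, (ρ - (I.ell x y i z v - x v - y i v)) ≤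
      ∑ v ∈ I.xBdry x y S i z ρ, x v :=
    Finset.sum_le_sum fun v hv => by linarith [(mem_xBdry.1 hv).2.1]
  rw [ballVol_eq, regionVol, sum_region (S := S) (i := i) (z := z) (ρ := ρ) hx hy]
  linarith

theorem coBallVol_le (hx : ∀ v, 0 ≤ x v) (hy : ∀ i v, 0 ≤ y i v) :
    I.coBallVol x y S i z ρ ≤ I.regionVol x S := by
  linarith [coBallVol_add_sum_ball_le (S := S) (i := i) (z := z) (ρ := ρ) hx hy,
    Finset.sum_nonneg fun v (_ : v ∈ I.ball x y S i z ρ) => hx v]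

theorem ballVol_le (hx : ∀ v, 0 ≤ x v) (hy : ∀ i v, 0 ≤ y i v) :
    I.ballVol x y S i z ρ ≤ I.regionVol x S := by
  linarith [ballVol_add_sum_coBall_le (S := S) (i := i) (z := z) (ρ := ρ) hx hy,
    Finset.sum_nonneg fun v (_ : v ∈ I.coBall x y S i z ρ) => hx v]

theorem regionVol_ball_le (hx : ∀ v, 0 ≤ x v) :
    I.regionVol x (I.ball x y S i z ρ) ≤ I.ballVol x y S i z ρ := by
  have h : 0 ≤ ∑ v ∈ I.xBdry x y S i z ρ, (ρ - (I.ell x y i z v - x v - y i v)) :=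
    Finset.sum_nonneg fun v hv => by linarith [(mem_xBdry.1 hv).2.2]
  rw [ballVol_eq, regionVol]
  linarith [Finset.sum_nonneg fun v (_ : v ∈ I.yBdry x y S i z ρ) => hx v]

theorem regionVol_coBall_le (hx : ∀ v, 0 ≤ x v) :
    I.regionVol x (I.coBall x y S i z ρ) ≤ I.coBallVol x y S i z ρ := by
  have h : 0 ≤ ∑ v ∈ I.xBdry x y S i z ρ, (I.ell x y i z v - y i v - ρ) :=
    Finset.sum_nonneg fun v hv => by linarith [(mem_xBdry.1 hv).2.1]
  rw [coBallVol_eq, regionVol]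
  linarith [Finset.sum_nonneg fun v (_ : v ∈ I.yBdry x y S i z ρ) => hx v]

theorem beta_le_regionVol (hx : ∀ v, 0 ≤ x v) : I.beta x ≤ I.regionVol x S := by
  rw [regionVol]
  linarith [Finset.sum_nonneg fun v (_ : v ∈ S) => hx v]

variable (I x y S i z) in
/-- The contribution of the node `v` to the volume of the ball of radius `ρ`. -/
noncomputable def absorbed (v : V) (ρ : ℝ) : ℝ :=
  if v ∈ I.ball x y S i z ρ ∪ I.bdry x y S i z ρ then
    max 0 (min (x v) (ρ - (I.ell x y i z v - x v - y i v))) else 0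

theorem absorbed_mono (v : V) : Monotone (I.absorbed x y S i z v) := by
  intro ρ ρ' h
  rw [absorbed, absorbed]
  split_ifs with h1 h2
  · gcongr
  · exact absurd (near_mono h h1) h2
  · exact le_max_left _ _
  · exact le_rfl

theorem absorbed_of_mem_xBdry
    (hv : v ∈ I.xBdry x y S i z ρ) :
    I.absorbed x y S i z v ρ = ρ - (I.ell x y i z v - x v - y i v) := by
  obtain ⟨hb, h1, h2⟩ := mem_xBdry.1 hv
  rw [absorbed, if_pos (Finset.mem_union_right _ hb), min_eq_right (by linarith),
    max_eq_right (by linarith)]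

/-- The index set `S` does not depend on the radius, so volumes at two radii can be compared node by
node. The truncation in `absorbed` is saturated at `x v` on the ball and on `Γ^y`, and inactive on
`Γ^x`. -/
theorem ballVol_eq_sum_absorbed (hx : ∀ v, 0 ≤ x v) (hy : ∀ i v, 0 ≤ y i v) :
    I.ballVol x y S i z ρ = I.beta x + ∑ v ∈ S, I.absorbed x y S i z v ρ := by
  have h1 : ∀ v ∈ I.ball x y S i z ρ, I.absorbed x y S i z v ρ = x v := fun v hv => by
    rw [absorbed, if_pos (Finset.mem_union_left _ hv), min_eq_left, max_eq_right (hx v)]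
    linarith [(mem_ball.1 hv).2.2, hy i v]
  have h2 : ∀ v ∈ I.yBdry x y S i z ρ, I.absorbed x y S i z v ρ = x v := fun v hv => by
    rw [absorbed, if_pos (Finset.mem_union_right _ (yBdry_subset hv)), min_eq_left,
      max_eq_right (hx v)]
    linarith [(mem_yBdry.1 hv).2.2]
  have h3 : ∀ v ∈ I.coBall x y S i z ρ, I.absorbed x y S i z v ρ = 0 := fun v hv => by
    rw [absorbed, if_neg]
    rw [Finset.mem_union]
    exact not_or.2 (mem_coBall.1 hv).2
  rw [ballVol_eq, sum_region (S := S) (i := i) (z := z) (ρ := ρ) hx hy, Finset.sum_congr rfl h1,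
    Finset.sum_congr rfl h2, Finset.sum_congr rfl h3,
    Finset.sum_congr rfl fun v hv => absorbed_of_mem_xBdry hv]
  simp only [Finset.sum_const_zero]
  ring

theorem ballVol_mono (hx : ∀ v, 0 ≤ x v) (hy : ∀ i v, 0 ≤ y i v) :
    Monotone (I.ballVol x y S i z) := by
  intro ρ ρ' h
  rw [ballVol_eq_sum_absorbed hx hy, ballVol_eq_sum_absorbed hx hy]
  gcongr with v
  exact absorbed_mono v h

/-- For slightly larger radii every node of `Γ^x` is still unsaturated, so its contribution has
grown by at least `ρ' - ρ`; no other contribution decreases. -/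
theorem ballVol_growth (hx : ∀ v, 0 ≤ x v) (hy : ∀ i v, 0 ≤ y i v) (ρ : ℝ) :
    ∀ᶠ ρ' in 𝓝[>] ρ, I.ballVol x y S i z ρ + (I.xBdry x y S i z ρ).card * (ρ' - ρ) ≤
      I.ballVol x y S i z ρ' := by
  have hev : ∀ᶠ ρ' in 𝓝[>] ρ, ∀ v ∈ I.xBdry x y S i z ρ, ρ' + y i v < I.ell x y i z v := by
    refine (Finset.eventually_all _).2 fun v hv => ?_
    refine nhdsWithin_le_nhds ?_
    have h : ρ < I.ell x y i z v - y i v := by linarith [(mem_xBdry.1 hv).2.1]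
    exact (eventually_lt_nhds h).mono fun ρ' h => by linarith
  filter_upwards [hev, self_mem_nhdsWithin] with ρ' hlt (hρ : ρ < ρ')
  rw [ballVol_eq_sum_absorbed hx hy, ballVol_eq_sum_absorbed hx hy, add_assoc]
  gcongr
  have hsub : I.xBdry x y S i z ρ ⊆ S := xBdry_subset.trans bdry_subset
  rw [← Finset.sum_sdiff hsub, ← Finset.sum_sdiff hsub, add_assoc]
  refine add_le_add (Finset.sum_le_sum fun v _ => absorbed_mono v hρ.le) ?_
  rw [← nsmul_eq_mul, ← Finset.sum_const, ← Finset.sum_add_distrib]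
  refine Finset.sum_le_sum fun v hv => ?_
  rw [absorbed_of_mem_xBdry hv, absorbed,
    if_pos (near_mono hρ.le (Finset.mem_union_right _ (xBdry_subset hv)))]
  refine le_max_of_le_right (le_min ?_ ?_)
  · linarith [hlt v hv]
  · linarith

end Region

/-! ### Existence of good radii -/

section GoodRadius

variable {V : Type u} {I : NodeMulticut V} [Fintype V] [DecidableEq V]
  {x : V → ℝ} {y : Fin I.r → V → ℝ} {S : Finset V} {i : Fin I.r} {ρ c : ℝ}

theorem source_mem_ball (h : I.LPFeasible x y) (hs : I.s i ∈ S) (hρ : 0 ≤ ρ) :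
    I.s i ∈ I.ball x y S i (I.s i) ρ :=
  mem_ball.2 ⟨hs, .refl _, (ell_self h.x_nonneg h.y_nonneg _).trans hρ⟩

/-- The sink has weight zero, so on the boundary it would be at distance at most `ρ < 1`, against
the path constraints. -/
theorem sink_mem_coBall (h : I.LPFeasible x y) (ht : I.t i ∈ S)
    (hr : I.graph.Reachable (I.s i) (I.t i)) (hρ : ρ < 1) :
    I.t i ∈ I.coBall x y S i (I.s i) ρ := by
  have h1 := h.one_le_ell hr
  refine mem_coBall.2 ⟨ht, fun hb => ?_, fun hb => ?_⟩
  · linarith [(mem_ball.1 hb).2.2]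
  · have := ell_le_of_mem_bdry h.x_nonneg h.y_nonneg hb
    rw [h.x_terminal _ ⟨i, Or.inr rfl⟩, h.y_sink i] at this
    linarith

theorem ConnAtLeast.ends_mem {a b : V} (h : I.ConnAtLeast S a b c) (hc : 0 < c) :
    a ∈ S ∧ b ∈ S ∧ I.graph.Reachable a b := by
  obtain ⟨P, hP, hcard⟩ := h
  have : 0 < P.card := by exact_mod_cast hc.trans_le hcard
  obtain ⟨p, hp⟩ := Finset.card_pos.1 this
  exact ⟨hP.1 p hp _ p.1.start_mem_support, hP.1 p hp _ p.1.end_mem_support, p.1.reachable⟩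

/-- Node-disjoint paths leave the ball through distinct boundary nodes. -/
theorem ConnAtLeast.le_card_bdry (h : I.LPFeasible x y)
    (hconn : I.ConnAtLeast S (I.s i) (I.t i) c) (hc : 0 < c) (h0 : 0 ≤ ρ) (h1 : ρ < 1) :
    c ≤ (I.bdry x y S i (I.s i) ρ).card := by
  obtain ⟨hs, ht, hr⟩ := hconn.ends_mem hc
  have hsb := source_mem_ball h hs h0
  have htc := mem_coBall.1 (sink_mem_coBall h ht hr h1)
  obtain ⟨P, hP, hcard⟩ := hconn
  refine hcard.trans ?_
  have hex : ∀ p : I.graph.Path (I.s i) (I.t i), ∃ w, p ∈ P →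
      w ∈ p.1.support ∧ w ∈ I.bdry x y S i (I.s i) ρ := by
    intro p
    obtain ⟨d, hd, hd1, hd2⟩ :=
      p.1.exists_boundary_dart (I.ball x y S i (I.s i) ρ : Set V) hsb htc.2.1
    have hmem := p.1.dart_snd_mem_support_of_mem_darts hd
    exact ⟨d.snd, fun hp => ⟨hmem, mem_bdry.2 ⟨⟨hP.1 p hp _ hmem, hd2⟩, d.fst, hd1, d.adj⟩⟩⟩
  choose f hf using hex
  have : P.card ≤ (I.bdry x y S i (I.s i) ρ).card := by
    refine Finset.card_le_card_of_injOn f (fun p hp => (hf p hp).2) fun p hp q hq heq => ?_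
    by_contra hne
    -- A node common to two of the paths is an end, but the source lies in the ball and the sink in
    -- the complement, neither on the boundary.
    rcases hP.2 p hp q hq hne (f p) (hf p hp).1 (heq ▸ (hf q hq).1) with hw | hw
    · exact Finset.disjoint_left.1 disjoint_ball_bdry hsb (hw ▸ (hf p hp).2)
    · exact htc.2.2 (hw ▸ (hf p hp).2)
  exact_mod_cast this

theorem regionVol_le (hx : ∀ v, 0 ≤ x v) (hr : 0 < I.r) :
    I.regionVol x S ≤ I.beta x * (I.r + 1) := by
  have h : ∑ v ∈ S, x v ≤ ∑ v, x v :=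
    Finset.sum_le_sum_of_subset_of_nonneg (Finset.subset_univ S) fun v _ _ => hx v
  have hr' : (0 : ℝ) < I.r := by exact_mod_cast hr
  have : I.beta x * I.r = ∑ v, x v := div_mul_cancel₀ _ hr'.ne'
  rw [regionVol]
  linarith

/-- The radii at which the `y`-boundary is a large part of the boundary have measure less than
`1 / √γ`. -/
theorem volume_large_yBdry_lt (h : I.LPFeasible x y) (hk : 2 ≤ I.k) {γ : ℝ} (hγ : 1 < γ) :
    volume {ρ : ℝ | √γ * ((I.k : ℝ) - 1) < ((I.yBdry x y S i (I.s i) ρ).card : ℝ)} <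
      ENNReal.ofReal (1 / √γ) := by
  have hk' : (1 : ℝ) ≤ (I.k : ℝ) - 1 := by
    have : (2 : ℝ) ≤ I.k := by exact_mod_cast hk
    linarith
  have hγ0 : 0 < √γ := Real.sqrt_pos.2 (by linarith)
  -- The least integer above `√γ(k-1)`. Rounding up makes the measure bound strict, which is needed
  -- because the three bounds add up to exactly 1.
  set q := ⌊√γ * ((I.k : ℝ) - 1)⌋₊ + 1 with hq
  have hqlt : √γ * ((I.k : ℝ) - 1) < q := by
    rw [hq]; push_cast; exact Nat.lt_floor_add_one _
  refine lt_of_le_of_lt (measure_mono ?_) ((volume_multiplicity_ge_le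
    (I.ell x y i (I.s i)) (y i) (h.y_nonneg i) (q := q) (by omega)).trans_lt ?_)
  · intro ρ hρ
    have h1 : q ≤ (I.yBdry x y S i (I.s i) ρ).card := (Nat.floor_lt (by positivity)).2 hρ
    exact h1.trans (Finset.card_le_card fun v hv => by simpa using (mem_yBdry.1 hv).2)
  · have hqpos : (0 : ℝ) < q := by positivity
    rw [ENNReal.ofReal_lt_ofReal_iff (by positivity), div_lt_div_iff₀ hqpos hγ0]
    have := mul_le_mul_of_nonneg_right (h.budget i) hγ0.le
    linarith

/-- Outside the radii with a large `y`-boundary, the `x`-boundary is a constant fraction of the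
boundary. -/
theorem card_bdry_le_of_small_yBdry (h : I.LPFeasible x y) (hk : 2 ≤ I.k) {γ : ℝ} (hγ : 1 < γ)
    (hconn : I.ConnAtLeast S (I.s i) (I.t i) (γ * ((I.k : ℝ) - 1))) (h0 : 0 ≤ ρ) (h1 : ρ < 1)
    (hρ : ((I.yBdry x y S i (I.s i) ρ).card : ℝ) ≤ √γ * ((I.k : ℝ) - 1)) :
    (√γ - 1) * ((I.bdry x y S i (I.s i) ρ).card : ℝ) ≤
      √γ * (I.xBdry x y S i (I.s i) ρ).card := by
  have hk' : (1 : ℝ) ≤ (I.k : ℝ) - 1 := by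
    have : (2 : ℝ) ≤ I.k := by exact_mod_cast hk
    linarith
  have hle := hconn.le_card_bdry h (by positivity) h0 h1
  have hcard : ((I.bdry x y S i (I.s i) ρ).card : ℝ) =
      (I.xBdry x y S i (I.s i) ρ).card + (I.yBdry x y S i (I.s i) ρ).card := by
    exact_mod_cast card_bdry h.x_nonneg h.y_nonneg
  have : √γ * ((I.yBdry x y S i (I.s i) ρ).card : ℝ) ≤ (I.bdry x y S i (I.s i) ρ).card := by
    calc √γ * ((I.yBdry x y S i (I.s i) ρ).card : ℝ) ≤ √γ * (√γ * ((I.k : ℝ) - 1)) := by gcongr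
      _ = γ * ((I.k : ℝ) - 1) := by rw [← mul_assoc, Real.mul_self_sqrt (by linarith)]
      _ ≤ _ := hle
  rw [hcard] at this ⊢
  linarith

/-- Some radius in `[0,1)` has a small `y`-boundary, hence a nonempty `x`-boundary, whose nodes have
positive `x`. This allows division by `β` and logarithms of volumes. -/
theorem beta_pos_of_connAtLeast (h : I.LPFeasible x y) (hk : 2 ≤ I.k) {γ : ℝ} (hγ : 1 < γ)
    (hconn : I.ConnAtLeast S (I.s i) (I.t i) (γ * ((I.k : ℝ) - 1))) : 0 < I.beta x := by
  have hk' : (1 : ℝ) ≤ (I.k : ℝ) - 1 := by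
    have : (2 : ℝ) ≤ I.k := by exact_mod_cast hk
    linarith
  have hγ0 : 0 < √γ := Real.sqrt_pos.2 (by linarith)
  have hγ1 : 1 < √γ := by rw [Real.lt_sqrt zero_le_one]; linarith
  set bad : Set ℝ :=
    {ρ : ℝ | √γ * ((I.k : ℝ) - 1) < ((I.yBdry x y S i (I.s i) ρ).card : ℝ)} with hbad
  have hvol : volume bad < volume (Set.Ico (0 : ℝ) 1) := by
    rw [Real.volume_Ico]
    refine (volume_large_yBdry_lt h hk hγ).trans_le (ENNReal.ofReal_le_ofReal ?_)
    rw [sub_zero, div_le_one hγ0]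
    exact hγ1.le
  obtain ⟨ρ, hρ, hρb⟩ : ∃ ρ ∈ Set.Ico (0 : ℝ) 1, ρ ∉ bad := by
    by_contra! hcon
    exact hvol.not_ge (measure_mono hcon)
  have h1 := card_bdry_le_of_small_yBdry h hk hγ hconn hρ.1 hρ.2 (not_lt.1 hρb)
  have h2 : 0 < ((I.bdry x y S i (I.s i) ρ).card : ℝ) :=
    lt_of_lt_of_le (by positivity) (hconn.le_card_bdry h (by positivity) hρ.1 hρ.2)
  have h3 : 0 < ((I.xBdry x y S i (I.s i) ρ).card : ℝ) :=
    pos_of_mul_pos_right ((mul_pos (sub_pos.2 hγ1) h2).trans_le h1) hγ0.le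
  obtain ⟨v, hv⟩ := Finset.card_pos.1 (Nat.cast_pos.1 h3)
  have hxv : 0 < x v := by
    have := (mem_xBdry.1 hv).2
    linarith
  exact div_pos (hxv.trans_le (Finset.single_le_sum (fun v _ => h.x_nonneg v)
    (Finset.mem_univ v))) (by exact_mod_cast i.pos)

theorem exists_goodRadius (h : I.LPFeasible x y) (hk : 2 ≤ I.k) {γ : ℝ} (hγ : 1 < γ)
    (hconn : I.ConnAtLeast S (I.s i) (I.t i) (γ * ((I.k : ℝ) - 1))) :
    ∃ ρ : ℝ, I.GoodRadius x y γ S i ρ := by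
  have hx := h.x_nonneg
  have hy := h.y_nonneg
  have hr : 0 < I.r := i.pos
  have hγ0 : 0 < √γ := Real.sqrt_pos.2 (by linarith)
  have hγ1 : 1 < √γ := by rw [Real.lt_sqrt zero_le_one]; linarith
  have hsq : √γ * √γ = γ := Real.mul_self_sqrt (by linarith)
  set z := I.s i with hz
  set bad : Set ℝ := {ρ : ℝ | √γ * ((I.k : ℝ) - 1) < ((I.yBdry x y S i z ρ).card : ℝ)} with hbad
  have hbadvol : volume bad < ENNReal.ofReal (1 / √γ) := volume_large_yBdry_lt h hk hγ
  have hnb : ∀ ρ, 0 ≤ ρ → ρ < 1 → ρ ∉ bad →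
      (√γ - 1) * ((I.bdry x y S i z ρ).card : ℝ) ≤ √γ * (I.xBdry x y S i z ρ).card :=
    fun ρ h0 h1 hρ => card_bdry_le_of_small_yBdry h hk hγ hconn h0 h1 (not_lt.1 hρ)
  have hβ : 0 < I.beta x := beta_pos_of_connAtLeast h hk hγ hconn
  set M := I.regionVol x S with hM
  set L := Real.log (Real.log (Real.exp 1 * ((I.r : ℝ) + 1))) with hL
  have hMβ : I.beta x ≤ M := beta_le_regionVol hx
  have hM0 : 0 < M := hβ.trans_le hMβ
  have hr1 : (1 : ℝ) ≤ I.r := by exact_mod_cast hr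
  have hL0 : 0 < L := by
    apply Real.log_pos
    rw [Real.lt_log_iff_exp_lt (by positivity)]
    exact lt_mul_of_one_lt_right (Real.exp_pos 1) (by linarith)
  have hML : Real.log (Real.log (Real.exp 1 * M / I.beta x)) ≤ L := by
    refine Real.log_le_log (zero_lt_one.trans_le (one_le_log_exp_mul_div hβ hMβ)) ?_
    refine Real.log_le_log (by positivity) ?_
    rw [mul_div_assoc]
    gcongr
    rw [div_le_iff₀ hβ, mul_comm]
    exact regionVol_le hx hr
  -- Chosen so that `L / c = (1 - 1/√γ) / 2`: the growth and decay conditions each get half of the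
  -- measure left over by the `y`-boundary condition.
  set c := 2 * √γ / (√γ - 1) * L with hc
  have hγ2 : 0 < √γ - 1 := sub_pos.2 hγ1
  have hc0 : 0 < c := by positivity
  have hbound : Real.log (Real.log (Real.exp 1 * M / I.beta x)) / c ≤ (1 - 1 / √γ) / 2 := by
    rw [div_le_iff₀ hc0]
    refine hML.trans (le_of_eq ?_)
    rw [hc]
    field_simp
  -- A monotone substitute for `coBallVol`, which can jump up when a node passes from `Γ^x` to
  -- `Γ^y`. It is smaller by the `x`-weight of `Γ^y`.
  let W' : ℝ → ℝ := fun ρ => I.beta x + M - I.ballVol x y S i z ρ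
  have hWlow : ∀ ρ, I.beta x ≤ I.ballVol x y S i z ρ :=
    fun ρ => (beta_le_regionVol hx).trans (regionVol_ball_le hx)
  have hWhigh : ∀ ρ, I.ballVol x y S i z ρ ≤ M := fun ρ => ballVol_le hx hy
  have hF1 := volume_fast_growth_le (W := I.ballVol x y S i z) (b := I.beta x) (M := M) (c := c)
    (n := fun ρ => ((I.xBdry x y S i z ρ).card : ℝ)) hβ hc0 hWlow hWhigh
    (ballVol_mono hx hy) (ballVol_growth hx hy)
  have hF2 := volume_fast_decay_le (W := W') (b := I.beta x) (M := M) (c := c)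
    (n := fun ρ => ((I.xBdry x y S i z ρ).card : ℝ)) hβ hc0
    (fun ρ => by have := hWhigh ρ; simp only [W']; linarith)
    (fun ρ => by have := hWlow ρ; simp only [W']; linarith)
    (fun ρ ρ' hρ => by have := ballVol_mono (S := S) (i := i) (z := z) hx hy hρ
                       simp only [W']; linarith)
    (fun ρ => (ballVol_growth hx hy ρ).mono fun ρ' h' => by simp only [W']; linarith)
  set F1 := {ρ ∈ Set.Ico (0 : ℝ) 1 | c * (I.ballVol x y S i z ρ *
    Real.log (Real.exp 1 * M / I.ballVol x y S i z ρ)) < ((I.xBdry x y S i z ρ).card : ℝ)}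
  set F2 := {ρ ∈ Set.Ico (0 : ℝ) 1 | c * (W' ρ * Real.log (Real.exp 1 * M / W' ρ)) <
    ((I.xBdry x y S i z ρ).card : ℝ)}
  obtain ⟨ρ, hρ, hρb, hρ1, hρ2⟩ : ∃ ρ ∈ Set.Ico (0 : ℝ) 1, ρ ∉ bad ∧ ρ ∉ F1 ∧ ρ ∉ F2 := by
    by_contra! hcon
    have hcov : Set.Ico (0 : ℝ) 1 ⊆ bad ∪ (F1 ∪ F2) := by
      intro ρ hρ
      by_cases hb : ρ ∈ bad
      · exact Or.inl hb
      by_cases h1 : ρ ∈ F1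
      · exact Or.inr (Or.inl h1)
      · exact Or.inr (Or.inr (hcon ρ hρ hb h1))
    have hq : 1 / √γ ≤ 1 := by rw [div_le_one hγ0]; exact hγ1.le
    have hF : volume (F1 ∪ F2) ≤ ENNReal.ofReal (1 - 1 / √γ) := by
      refine (measure_union_le _ _).trans ((add_le_add hF1 hF2).trans ?_)
      refine (add_le_add (ENNReal.ofReal_le_ofReal hbound)
        (ENNReal.ofReal_le_ofReal hbound)).trans (le_of_eq ?_)
      rw [← ENNReal.ofReal_add (by linarith) (by linarith)]
      congr 1
      ring
    have hlt : volume (Set.Ico (0 : ℝ) 1) < ENNReal.ofReal 1 :=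
      calc volume (Set.Ico (0 : ℝ) 1) ≤ volume bad + volume (F1 ∪ F2) :=
            (measure_mono hcov).trans (measure_union_le _ _)
        _ < ENNReal.ofReal (1 / √γ) + ENNReal.ofReal (1 - 1 / √γ) :=
            ENNReal.add_lt_add_of_lt_of_le (ne_top_of_le_ne_top ENNReal.ofReal_ne_top hF)
              hbadvol hF
        _ = ENNReal.ofReal 1 := by
            rw [← ENNReal.ofReal_add (by positivity) (by linarith)]
            congr 1
            ring
    rw [Real.volume_Ico, sub_zero] at hlt
    exact lt_irrefl _ hlt
  have hfin : ∀ W : ℝ, ((I.xBdry x y S i z ρ).card : ℝ) ≤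
      c * (W * Real.log (Real.exp 1 * M / W)) →
      ((I.bdry x y S i z ρ).card : ℝ) ≤
        2 * γ / (√γ - 1) ^ 2 * W * Real.log (Real.exp 1 * M / W) * L := by
    intro W hW
    have h1 := hnb ρ hρ.1 hρ.2 hρb
    have h2 : ((I.bdry x y S i z ρ).card : ℝ) ≤
        √γ / (√γ - 1) * (I.xBdry x y S i z ρ).card := by
      rw [div_mul_eq_mul_div, le_div_iff₀ hγ2, mul_comm]
      exact h1
    refine h2.trans ((mul_le_mul_of_nonneg_left hW (by positivity)).trans (le_of_eq ?_))
    rw [hc, ← hsq]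
    simp only [Real.sqrt_mul_self hγ0.le]
    field_simp
  refine ⟨ρ, hρ.1, hρ.2, hfin _ (not_lt.1 fun hlt => hρ1 ⟨hρ, hlt⟩), hfin _ ?_⟩
  refine (not_lt.1 fun hlt => hρ2 ⟨hρ, hlt⟩).trans ?_
  -- Since `W' ≤ coBallVol ≤ M`, the bound for `W'` passes to `coBallVol`.
  refine mul_le_mul_of_nonneg_left (mul_log_exp_mul_div_mono ?_ ?_ (coBallVol_le hx hy)) hc0.le
  · have := hWhigh ρ
    simp only [W']
    linarith
  · have h1 := ballVol_add_coBallVol (S := S) (i := i) (z := z) (ρ := ρ) hx hy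
    have h2 := Finset.sum_nonneg fun v (_ : v ∈ I.yBdry x y S i z ρ) => hx v
    simp only [W']
    linarith

end GoodRadius

/-! ### One iteration of the loop -/

section Carve

variable {V : Type u} {I : NodeMulticut V} [Fintype V] [DecidableEq V]
  {x : V → ℝ} {y : Fin I.r → V → ℝ} {S A D : Finset V} {T : Finset (Fin I.r)} {i : Fin I.r}
  {ρ γ : ℝ}

theorem mem_pairsIn {j : Fin I.r} : j ∈ I.pairsIn T A ↔ j ∈ T ∧ I.s j ∈ A ∧ I.t j ∈ A := by
  simp [pairsIn]

theorem pairsIn_mono (h : A ⊆ D) : I.pairsIn T A ⊆ I.pairsIn T D := fun j hj => by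
  rw [mem_pairsIn] at hj ⊢
  exact ⟨hj.1, h hj.2.1, h hj.2.2⟩

theorem pairsIn_disjoint (h : Disjoint A D) : Disjoint (I.pairsIn T A) (I.pairsIn T D) :=
  Finset.disjoint_left.2 fun _ hj hj' =>
    Finset.disjoint_left.1 h (mem_pairsIn.1 hj).2.1 (mem_pairsIn.1 hj').2.1

theorem sdiff_ball_bdry : S \ (I.ball x y S i (I.s i) ρ ∪ I.bdry x y S i (I.s i) ρ) =
    I.coBall x y S i (I.s i) ρ := rfl

theorem sdiff_coBall_bdry : S \ (I.coBall x y S i (I.s i) ρ ∪ I.bdry x y S i (I.s i) ρ) =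
    I.ball x y S i (I.s i) ρ := by
  ext v
  have h1 := @ball_subset _ I _ _ x y S i (I.s i) ρ v
  have h2 : v ∈ I.ball x y S i (I.s i) ρ → v ∉ I.bdry x y S i (I.s i) ρ :=
    fun hb => Finset.disjoint_left.1 disjoint_ball_bdry hb
  rw [Finset.mem_sdiff, Finset.mem_union, mem_coBall]
  tauto

/-- If the complement is carved out, more than half of the pairs lie in `B ∪ Γ^y`, which is disjoint
from it. -/
theorem card_pairsIn_carve_le :
    2 * (I.pairsIn T (I.carve x y T S i ρ)).card ≤ T.card := by
  rw [carve]
  split_ifs with h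
  · refine le_trans (Nat.mul_le_mul_left 2 (Finset.card_le_card (pairsIn_mono ?_))) h
    exact Finset.subset_union_left
  · have hd : Disjoint (I.coBall x y S i (I.s i) ρ)
        (I.ball x y S i (I.s i) ρ ∪ I.yBdry x y S i (I.s i) ρ) :=
      Finset.disjoint_union_right.2
        ⟨disjoint_coBall_ball, disjoint_coBall_bdry.mono_right yBdry_subset⟩
    have h1 := Finset.card_union_of_disjoint (pairsIn_disjoint (I := I) (T := T) hd)
    have h2 : (I.pairsIn T (I.coBall x y S i (I.s i) ρ) ∪
        I.pairsIn T (I.ball x y S i (I.s i) ρ ∪ I.yBdry x y S i (I.s i) ρ)).card ≤ T.card :=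
      Finset.card_le_card (Finset.union_subset (Finset.filter_subset _ _)
        (Finset.filter_subset _ _))
    omega

theorem carve_subset : I.carve x y T S i ρ ⊆ S := by
  rw [carve]
  split_ifs
  exacts [ball_subset, coBall_subset]

/-- The pair that triggers an iteration is separated by it. -/
theorem carve_separates (hs : I.s i ∈ I.ball x y S i (I.s i) ρ)
    (ht : I.t i ∈ I.coBall x y S i (I.s i) ρ) :
    (I.s i ∈ I.carve x y T S i ρ ∧ I.t i ∉ I.carve x y T S i ρ) ∨
      (I.s i ∉ I.carve x y T S i ρ ∧ I.t i ∈ I.carve x y T S i ρ) := by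
  have hd := Finset.disjoint_left.1 (@disjoint_coBall_ball _ I _ _ x y S i (I.s i) ρ)
  rw [carve]
  split_ifs
  · exact Or.inl ⟨hs, hd ht⟩
  · exact Or.inr ⟨fun h => hd h hs, ht⟩

/-- The `+ 1` is the triggering pair, which survives on neither side; it will pay for the `β` in the
volume of the carved-out set. -/
theorem card_pairsIn_split (hi : i ∈ T) (hs : I.s i ∈ I.ball x y S i (I.s i) ρ)
    (ht : I.t i ∈ I.coBall x y S i (I.s i) ρ) :
    (I.pairsIn T (S \ (I.carve x y T S i ρ ∪ I.bdry x y S i (I.s i) ρ))).card +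
      (I.pairsIn T (I.carve x y T S i ρ)).card + 1 ≤ (I.pairsIn T S).card := by
  have hsep := carve_separates (T := T) hs ht
  set A := I.carve x y T S i ρ with hA
  have hd : Disjoint (S \ (A ∪ I.bdry x y S i (I.s i) ρ)) A :=
    Finset.disjoint_left.2 fun v hv hvA =>
      (Finset.mem_sdiff.1 hv).2 (Finset.mem_union_left _ hvA)
  rw [← Finset.card_union_of_disjoint (pairsIn_disjoint hd), ← Finset.card_insert_of_notMem
    (a := i)]
  · refine Finset.card_le_card (Finset.insert_subset ?_ (Finset.union_subset
      (pairsIn_mono Finset.sdiff_subset) (pairsIn_mono carve_subset)))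
    exact mem_pairsIn.2 ⟨hi, ball_subset hs, coBall_subset ht⟩
  · rw [Finset.mem_union, mem_pairsIn, mem_pairsIn, Finset.mem_sdiff, Finset.mem_sdiff,
      Finset.mem_union, Finset.mem_union]
    tauto

/-- Some volume `W` pays for the boundary and dominates the volume of the carved-out set. -/
theorem GoodRadius.exists_volume (hx : ∀ v, 0 ≤ x v) (hy : ∀ i v, 0 ≤ y i v)
    (h : I.GoodRadius x y γ S i ρ) (T : Finset (Fin I.r)) :
    ∃ W, I.regionVol x (I.carve x y T S i ρ) ≤ W ∧
      W + ∑ v ∈ S \ (I.carve x y T S i ρ ∪ I.bdry x y S i (I.s i) ρ), x v ≤ I.regionVol x S ∧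
      ((I.bdry x y S i (I.s i) ρ).card : ℝ) ≤ 2 * γ / (√γ - 1) ^ 2 * W
        * Real.log (Real.exp 1 * I.regionVol x S / W)
        * Real.log (Real.log (Real.exp 1 * ((I.r : ℝ) + 1))) := by
  obtain ⟨-, -, h1, h2⟩ := h
  rw [carve]
  split_ifs
  · exact ⟨_, regionVol_ball_le hx, by rw [sdiff_ball_bdry]; exact ballVol_add_sum_coBall_le hx hy,
      h1⟩
  · exact ⟨_, regionVol_coBall_le hx,
      by rw [sdiff_coBall_bdry]; exact coBallVol_add_sum_ball_le hx hy, h2⟩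

variable (I) in
/-- No edge leads from `A` to a node of `D` outside `A`. -/
def ClosedIn (D A : Finset V) : Prop := ∀ u ∈ A, ∀ v ∈ D, I.graph.Adj u v → v ∈ A

theorem ClosedIn.support_subset (h : I.ClosedIn D A) {a b : V} (p : I.graph.Walk a b)
    (hp : ∀ w ∈ p.support, w ∈ D) (ha : a ∈ A) : ∀ w ∈ p.support, w ∈ A := by
  induction p with
  | nil => simpa using ha
  | cons hadj p ih =>
    rw [SimpleGraph.Walk.support_cons] at hp ⊢
    have hp' := fun w hw => hp w (List.mem_cons_of_mem _ hw)
    intro w hw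
    rcases List.mem_cons.1 hw with rfl | hw
    · exact ha
    · exact ih hp' (h _ ha _ (hp' _ p.start_mem_support) hadj) w hw

theorem closedIn_ball : I.ClosedIn (S \ I.bdry x y S i (I.s i) ρ) (I.ball x y S i (I.s i) ρ) := by
  intro u hu v hv hadj
  rw [Finset.mem_sdiff] at hv
  by_contra hb
  exact hv.2 (mem_bdry.2 ⟨⟨hv.1, hb⟩, u, hu, hadj⟩)

theorem closedIn_coBall :
    I.ClosedIn (S \ I.bdry x y S i (I.s i) ρ) (I.coBall x y S i (I.s i) ρ) := by
  intro u hu v hv hadj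
  rw [Finset.mem_sdiff] at hv
  have hu' := mem_coBall.1 hu
  refine mem_coBall.2 ⟨hv.1, fun hb => hu'.2.2 ?_, hv.2⟩
  exact mem_bdry.2 ⟨⟨hu'.1, hu'.2.1⟩, v, hb, hadj.symm⟩

theorem closedIn_carve (T : Finset (Fin I.r)) :
    I.ClosedIn (S \ I.bdry x y S i (I.s i) ρ) (I.carve x y T S i ρ) ∧
      I.ClosedIn (S \ I.bdry x y S i (I.s i) ρ)
        (S \ (I.carve x y T S i ρ ∪ I.bdry x y S i (I.s i) ρ)) := by
  rw [carve]
  split_ifs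
  · rw [sdiff_ball_bdry]
    exact ⟨closedIn_ball, closedIn_coBall⟩
  · rw [sdiff_coBall_bdry]
    exact ⟨closedIn_coBall, closedIn_ball⟩

end Carve

/-! ### Termination and connectivity of the output -/

section Algorithm

variable {V : Type u} {I : NodeMulticut V} [Fintype V] [DecidableEq V]
  {x : V → ℝ} {y : Fin I.r → V → ℝ} {U S Z : Finset V} {T : Finset (Fin I.r)}
  {C : Finset (Finset V)} {i : Fin I.r} {γ : ℝ}

theorem LoopReaches.subset (h : I.LoopReaches x y γ U T S C Z) : S ⊆ U := by
  induction h with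
  | start => exact subset_rfl
  | step S C Z i ρ _ _ _ _ ih => exact Finset.sdiff_subset.trans ih

theorem threshold_pos (hk : 2 ≤ I.k) (hγ : 1 < γ) : 0 < γ * ((I.k : ℝ) - 1) := by
  have : (2 : ℝ) ≤ I.k := by exact_mod_cast hk
  exact mul_pos (by linarith) (by linarith)

theorem GoodRadius.ends_mem (h : I.LPFeasible x y) (hk : 2 ≤ I.k) (hγ : 1 < γ) {ρ : ℝ}
    (hconn : I.ConnAtLeast S (I.s i) (I.t i) (γ * ((I.k : ℝ) - 1)))
    (hρ : I.GoodRadius x y γ S i ρ) :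
    I.s i ∈ I.ball x y S i (I.s i) ρ ∧ I.t i ∈ I.coBall x y S i (I.s i) ρ := by
  obtain ⟨hs, ht, hr⟩ := hconn.ends_mem (threshold_pos hk hγ)
  exact ⟨source_mem_ball h hs hρ.1, sink_mem_coBall h ht hr hρ.2.1⟩

/-- The carved-out set contains exactly one end of the triggering pair. Hence the region shrinks, so
the loop ends, and the carved-out set is strictly smaller than `U`, so the recursion ends too. -/
theorem LoopReaches.exists_terminal (h : I.LPFeasible x y) (hk : 2 ≤ I.k) (hγ : 1 < γ)
    (hS : I.LoopReaches x y γ U T S C Z) (hC : ∀ A ∈ C, A.card < U.card) :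
    ∃ S' C' Z', I.LoopReaches x y γ U T S' C' Z' ∧ (∀ A ∈ C', A.card < U.card) ∧
      ∀ i ∈ T, ¬ I.ConnAtLeast S' (I.s i) (I.t i) (γ * ((I.k : ℝ) - 1)) := by
  induction hn : S.card using Nat.strong_induction_on generalizing S C Z with
  | _ n ih =>
    by_cases hdone : ∀ i ∈ T, ¬ I.ConnAtLeast S (I.s i) (I.t i) (γ * ((I.k : ℝ) - 1))
    · exact ⟨S, C, Z, hS, hC, hdone⟩
    push Not at hdone
    obtain ⟨i, hi, hconn⟩ := hdone
    obtain ⟨ρ, hρ⟩ := exists_goodRadius h hk hγ hconn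
    obtain ⟨hs, ht⟩ := hρ.ends_mem h hk hγ hconn
    have hsep := carve_separates (T := T) hs ht
    have hsub : I.carve x y T S i ρ ⊆ S := carve_subset
    refine ih _ ?_ (hS.step S C Z i ρ hi hconn hρ) ?_ rfl
    · rw [← hn]
      refine Finset.card_lt_card ⟨Finset.sdiff_subset, fun hcon => ?_⟩
      have hs' := Finset.mem_sdiff.1 (hcon (ball_subset hs))
      have ht' := Finset.mem_sdiff.1 (hcon (coBall_subset ht))
      rw [Finset.mem_union] at hs' ht'
      tauto
    · intro A hA
      rcases Finset.mem_insert.1 hA with rfl | hA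
      · refine lt_of_lt_of_le (Finset.card_lt_card ⟨hsub, fun hcon => ?_⟩)
          (Finset.card_le_card hS.subset)
        have hs' := hcon (ball_subset hs)
        have ht' := hcon (coBall_subset ht)
        tauto
      · exact hC A hA

theorem exists_returns (h : I.LPFeasible x y) (hk : 2 ≤ I.k) (hγ : 1 < γ) (U : Finset V)
    (T : Finset (Fin I.r)) : ∃ Z, I.Returns x y γ U T Z := by
  induction hn : U.card using Nat.strong_induction_on generalizing U T with
  | _ n ih =>
    obtain ⟨S, C, Z, hS, hC, hdone⟩ := LoopReaches.exists_terminal h hk hγ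
      (LoopReaches.start : I.LoopReaches x y γ U T U ∅ ∅) (by simp)
    have hex : ∀ A : Finset V, ∃ Z', A ∈ C → I.Returns x y γ A (I.pairsIn T A) Z' := by
      intro A
      by_cases hA : A ∈ C
      · obtain ⟨Z', hZ'⟩ := ih A.card (hn ▸ hC A hA) A (I.pairsIn T A) rfl
        exact ⟨Z', fun _ => hZ'⟩
      · exact ⟨∅, fun h => absurd h hA⟩
    choose Zrec hZrec using hex
    exact ⟨_, .intro U T S C Z Zrec hS hdone hZrec⟩

/-- The loop invariant behind correctness: once `Z` is deleted, the region and the carved-out sets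
cover `U`, and no edge leaves any of them. -/
theorem LoopReaches.separated (h : I.LoopReaches x y γ U T S C Z) :
    U \ Z ⊆ S ∪ C.biUnion id ∧ I.ClosedIn (U \ Z) S ∧ ∀ A ∈ C, I.ClosedIn (U \ Z) A := by
  induction h with
  | start => exact ⟨by simp, fun u _ v hv _ => (Finset.mem_sdiff.1 hv).1, by simp⟩
  | step S C Z i ρ _ _ _ _ ih =>
    obtain ⟨hcov, hS, hC⟩ := ih
    set A := I.carve x y T S i ρ
    set B := I.bdry x y S i (I.s i) ρ with hB
    have hmono : U \ (Z ∪ B) ⊆ U \ Z := Finset.sdiff_subset_sdiff subset_rfl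
      Finset.subset_union_left
    have hcl := closedIn_carve (I := I) (x := x) (y := y) (S := S) (i := i) (ρ := ρ) T
    have hAS : A ⊆ S := carve_subset
    have hred : ∀ E ⊆ S, I.ClosedIn (S \ B) E → I.ClosedIn (U \ (Z ∪ B)) E := by
      intro E hE hcE u hu v hv hadj
      refine hcE u hu v (Finset.mem_sdiff.2 ⟨hS u (hE hu) v (hmono hv) hadj, fun hvB => ?_⟩) hadj
      exact (Finset.mem_sdiff.1 hv).2 (Finset.mem_union_right _ hvB)
    refine ⟨fun v hv => ?_, hred _ Finset.sdiff_subset hcl.2, fun E hE => ?_⟩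
    · have h1 := hcov (hmono hv)
      have h2 := (Finset.mem_sdiff.1 hv).2
      simp only [Finset.mem_union, Finset.mem_biUnion, Finset.mem_insert, Finset.mem_sdiff,
        id, exists_eq_or_imp] at h1 h2 ⊢
      tauto
    · rcases Finset.mem_insert.1 hE with rfl | hE
      · exact hred _ hAS hcl.1
      · exact fun u hu v hv hadj => hC E hE u hu v (hmono hv) hadj

/-- All surviving paths of a pair lie in the piece containing its source. If this is the final
region, the exit condition of the loop applies; if it is a carved-out set, it contains the sink as
well, so the recursive call handles the pair. -/
theorem Returns.connLess (hk : 2 ≤ I.k) (hγ : 1 < γ) (h : I.Returns x y γ U T Z) :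
    ∀ i ∈ T, I.ConnLess (U \ Z) (I.s i) (I.t i) (γ * ((I.k : ℝ) - 1)) := by
  induction h with
  | intro U T S C Z Zrec hloop hdone _ ih =>
    intro i hi P hP
    by_contra hcard
    rw [not_lt] at hcard
    obtain ⟨hs, ht, -⟩ := ConnAtLeast.ends_mem ⟨P, hP, hcard⟩ (threshold_pos hk hγ)
    obtain ⟨hcov, hS, hC⟩ := hloop.separated
    have hsub : U \ (Z ∪ C.biUnion Zrec) ⊆ U \ Z :=
      Finset.sdiff_subset_sdiff subset_rfl Finset.subset_union_left
    have hin : ∀ A, I.ClosedIn (U \ Z) A → I.s i ∈ A → ∀ p ∈ P, ∀ w ∈ p.1.support, w ∈ A :=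
      fun A hA hsA p hp => hA.support_subset p.1 (fun w hw => hsub (hP.1 p hp w hw)) hsA
    rcases Finset.mem_union.1 (hcov (hsub hs)) with hsS | hsC
    · exact hdone i hi ⟨P, ⟨hin S hS hsS, hP.2⟩, hcard⟩
    · obtain ⟨A, hA, hsA⟩ := Finset.mem_biUnion.1 hsC
      have hinA := hin A (hC A hA) hsA
      have hdis : I.NodeDisjoint (A \ Zrec A) P := by
        refine ⟨fun p hp w hw => Finset.mem_sdiff.2 ⟨hinA p hp w hw, fun hwZ => ?_⟩, hP.2⟩
        exact (Finset.mem_sdiff.1 (hP.1 p hp w hw)).2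
          (Finset.mem_union_right _ (Finset.mem_biUnion.2 ⟨A, hA, hwZ⟩))
      have hends : I.t i ∈ A := by
        obtain ⟨-, ht', -⟩ := ConnAtLeast.ends_mem ⟨P, hdis, hcard⟩ (threshold_pos hk hγ)
        exact (Finset.mem_sdiff.1 ht').1
      exact (ih A hA i (mem_pairsIn.2 ⟨hi, hsA, hends⟩) P hdis).not_ge hcard

/-- A boundary node satisfies `ρ < ℓ ≤ ρ + x + y`, and terminals have `x = 0`. -/
theorem LoopReaches.terminal_pos (h : I.LPFeasible x y) (hS : I.LoopReaches x y γ U T S C Z) :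
    ∀ v ∈ Z, I.IsTerminal v → ∃ i, 0 < y i v := by
  induction hS with
  | start => simp
  | step S C Z i ρ _ _ _ _ ih =>
    intro v hv hterm
    rcases Finset.mem_union.1 hv with hv | hv
    · exact ih v hv hterm
    · have h1 := lt_ell_of_mem_bdry hv
      have h2 := ell_le_of_mem_bdry h.x_nonneg h.y_nonneg hv
      rw [h.x_terminal v hterm] at h2
      exact ⟨i, by linarith⟩

theorem Returns.terminal_pos (h : I.LPFeasible x y) (hZ : I.Returns x y γ U T Z) :
    ∀ v ∈ Z, I.IsTerminal v → ∃ i, 0 < y i v := by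
  induction hZ with
  | intro U T S C Z Zrec hloop _ _ ih =>
    intro v hv hterm
    rcases Finset.mem_union.1 hv with hv | hv
    · exact hloop.terminal_pos h v hv hterm
    · obtain ⟨A, hA, hvA⟩ := Finset.mem_biUnion.1 hv
      exact ih A hA v hvA hterm

theorem LoopReaches.eq_empty (hT : ∀ S, ∀ i ∈ T,
    ¬ I.ConnAtLeast S (I.s i) (I.t i) (γ * ((I.k : ℝ) - 1)))
    (h : I.LoopReaches x y γ U T S C Z) : C = ∅ ∧ Z = ∅ := by
  cases h with
  | start => exact ⟨rfl, rfl⟩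
  | step S C Z i ρ _ hi hconn _ => exact absurd hconn (hT S i hi)

theorem Returns.eq_empty (hT : ∀ S, ∀ i ∈ T,
    ¬ I.ConnAtLeast S (I.s i) (I.t i) (γ * ((I.k : ℝ) - 1)))
    (h : I.Returns x y γ U T Z) : Z = ∅ := by
  cases h with
  | intro _ _ S C Z Zrec hloop _ _ =>
    obtain ⟨rfl, rfl⟩ := hloop.eq_empty hT
    simp

end Algorithm

/-! ### The potential argument for the cost -/

section Cost

variable {V : Type u} {I : NodeMulticut V} [Fintype V] [DecidableEq V]
  {x : V → ℝ} {y : Fin I.r → V → ℝ} {U S Z : Finset V} {T : Finset (Fin I.r)}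
  {C : Finset (Finset V)} {i : Fin I.r} {γ : ℝ}

variable (I x) in
/-- The price per unit of volume in a call with arguments `(U, T)`. -/
noncomputable def price (U : Finset V) (T : Finset (Fin I.r)) : ℝ :=
  1 + Real.log (I.regionVol x U) - Real.log (I.beta x) + 2 * Real.log T.card

variable (I x) in
/-- The bound on the cost of a call with arguments `(U, T)`, up to a constant factor. -/
noncomputable def callBound (U : Finset V) (T : Finset (Fin I.r)) : ℝ :=
  if T = ∅ then 0 else (∑ v ∈ U, x v + I.beta x * T.card) * I.price x U T

variable (I γ) in
/-- The factor of the region-growing bound that depends on `γ` and `r` only. -/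
noncomputable def rate : ℝ :=
  2 * γ / (√γ - 1) ^ 2 * Real.log (Real.log (Real.exp 1 * ((I.r : ℝ) + 1)))

theorem log_log_nonneg (r : ℕ) : 0 ≤ Real.log (Real.log (Real.exp 1 * ((r : ℝ) + 1))) := by
  refine Real.log_nonneg ?_
  rw [Real.le_log_iff_exp_le (by positivity)]
  exact le_mul_of_one_le_right (Real.exp_pos 1).le (by linarith [(r.cast_nonneg : (0 : ℝ) ≤ r)])

theorem rate_nonneg (hγ : 1 < γ) : 0 ≤ I.rate γ := by
  have := log_log_nonneg I.r
  rw [rate]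
  positivity

theorem price_nonneg (hx : ∀ v, 0 ≤ x v) (hβ : 0 < I.beta x) : 0 ≤ I.price x U T := by
  have h1 : Real.log (I.beta x) ≤ Real.log (I.regionVol x U) :=
    Real.log_le_log hβ (beta_le_regionVol hx)
  have h2 := Real.log_natCast_nonneg T.card
  rw [price]
  linarith

theorem callBound_nonneg (hx : ∀ v, 0 ≤ x v) (hβ : 0 < I.beta x) : 0 ≤ I.callBound x U T := by
  rw [callBound]
  split_ifs
  · exact le_rfl
  · have := Finset.sum_nonneg fun v (_ : v ∈ U) => hx v
    exact mul_nonneg (by positivity) (price_nonneg hx hβ)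

theorem regionVol_mono (hx : ∀ v, 0 ≤ x v) (h : S ⊆ U) : I.regionVol x S ≤ I.regionVol x U := by
  rw [regionVol, regionVol]
  gcongr
  exact fun _ _ _ => hx _

/-- The cost of an iteration together with the cost of the call on the carved-out set. -/
theorem iteration_cost_le (hx : ∀ v, 0 ≤ x v) (hβ : 0 < I.beta x) (hT : T.Nonempty)
    {A : Finset V} {T' : Finset (Fin I.r)} (hT' : 2 * T'.card ≤ T.card) {W : ℝ}
    (hA : I.regionVol x A ≤ W) (hWU : W ≤ I.regionVol x U) :
    W * (1 + Real.log (I.regionVol x U) - Real.log W) + I.callBound x A T' ≤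
      (W + I.beta x * T'.card) * I.price x U T := by
  have hTpos : 0 < T.card := hT.card_pos
  have hβA : I.beta x ≤ I.regionVol x A := beta_le_regionVol hx
  have hW0 : 0 < W := hβ.trans_le (hβA.trans hA)
  have hlβW : Real.log (I.beta x) ≤ Real.log W := Real.log_le_log hβ (hβA.trans hA)
  have hlWU : Real.log W ≤ Real.log (I.regionVol x U) := Real.log_le_log hW0 hWU
  have hlAW : Real.log (I.regionVol x A) ≤ Real.log W := Real.log_le_log (hβ.trans_le hβA) hA
  have hlT := Real.log_natCast_nonneg T.card
  rw [callBound]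
  -- The case without pairs is separate: `Real.log 0 = 0`, so the halving estimate below would fail,
  -- but such a call has bound 0.
  split_ifs with hempty
  · subst hempty
    rw [add_zero, Finset.card_empty, Nat.cast_zero, mul_zero, add_zero, price]
    gcongr
    linarith
  · have hT'pos : 0 < T'.card := Finset.card_pos.2 (Finset.nonempty_iff_ne_empty.2 hempty)
    have hlT' : Real.log T'.card + Real.log 2 ≤ Real.log T.card := by
      rw [← Real.log_mul (by positivity) two_ne_zero]
      refine Real.log_le_log (by positivity) ?_
      rw [mul_comm]
      exact_mod_cast hT'
    have hprice : I.price x A T' ≤ Real.log W - Real.log (I.beta x) + 2 * Real.log T.card := by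
      rw [price]
      -- Halving the pairs saves `2 ln 2 ≥ 1`, which absorbs the constant 1 of the price; this is
      -- why `ln|T|` has weight 2.
      linarith [Real.log_two_gt_d9]
    have hsum : ∑ v ∈ A, x v ≤ W - I.beta x := by
      rw [regionVol] at hA
      linarith
    set n : ℝ := (T'.card : ℝ) with hn
    have hn0 : 0 ≤ n := Nat.cast_nonneg _
    have hX : 0 ≤ W - I.beta x := sub_nonneg.2 (hβA.trans hA)
    have h1 : (∑ v ∈ A, x v + I.beta x * n) * I.price x A T' ≤ (W - I.beta x + I.beta x * n) *
        (Real.log W - Real.log (I.beta x) + 2 * Real.log T.card) :=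
      mul_le_mul (by linarith) hprice (price_nonneg hx hβ) (by positivity)
    refine (add_le_add_right h1 _).trans ?_
    rw [price]
    have h2 := mul_nonneg hβ.le (by linarith :
      0 ≤ Real.log W - Real.log (I.beta x) + 2 * Real.log T.card)
    have h3 := mul_nonneg (mul_nonneg hβ.le hn0) (by linarith :
      0 ≤ 1 + Real.log (I.regionVol x U) - Real.log W)
    linarith

/-- The loop invariant of the potential: deleted nodes, bounds for the pending calls and the budget
of the remaining region, priced as in the original call, stay within the initial budget. -/
theorem LoopReaches.cost_le (h : I.LPFeasible x y) (hk : 2 ≤ I.k) (hγ : 1 < γ)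
    (hS : I.LoopReaches x y γ U T S C Z) (hβ : 0 < I.beta x) :
    (Z.card : ℝ) + ∑ A ∈ C, I.rate γ * I.callBound x A (I.pairsIn T A) +
      I.rate γ * ((∑ v ∈ S, x v + I.beta x * (I.pairsIn T S).card) * I.price x U T) ≤
      I.rate γ * ((∑ v ∈ U, x v + I.beta x * T.card) * I.price x U T) := by
  have hx := h.x_nonneg
  have ha := rate_nonneg (I := I) hγ
  induction hS with
  | start =>
    simp only [Finset.card_empty, Nat.cast_zero, Finset.sum_empty, zero_add]
    have := price_nonneg (U := U) (T := T) hx hβ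
    gcongr
    exact Finset.filter_subset _ _
  | step S C Z i ρ hS hi hconn hρ ih =>
    refine le_trans ?_ ih
    obtain ⟨hs, ht⟩ := hρ.ends_mem h hk hγ hconn
    obtain ⟨W, hW1, hW2, hW3⟩ := hρ.exists_volume hx h.y_nonneg T
    have hpairs := card_pairsIn_split hi hs ht
    have hhalf : 2 * (I.pairsIn T (I.carve x y T S i ρ)).card ≤ T.card := card_pairsIn_carve_le
    set A := I.carve x y T S i ρ
    set S' := S \ (A ∪ I.bdry x y S i (I.s i) ρ)
    have hSU := regionVol_mono (I := I) hx hS.subset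
    have hS'0 := Finset.sum_nonneg fun v (_ : v ∈ S') => hx v
    have hWS : W ≤ I.regionVol x S := by linarith
    have hW0 : 0 < W := hβ.trans_le ((beta_le_regionVol hx).trans hW1)
    have hprice := price_nonneg (U := U) (T := T) hx hβ
    have hit := iteration_cost_le hx hβ ⟨i, hi⟩ hhalf hW1 (hWS.trans hSU)
    have hΓ : ((I.bdry x y S i (I.s i) ρ).card : ℝ) ≤
        I.rate γ * (W * (1 + Real.log (I.regionVol x U) - Real.log W)) := by
      refine hW3.trans ?_
      rw [log_exp_mul_div_eq hW0 (hW0.trans_le hWS)]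
      have hl := Real.log_le_log (hW0.trans_le hWS) hSU
      calc _ = I.rate γ * (W * (1 + Real.log (I.regionVol x S) - Real.log W)) := by
            rw [rate]; ring
        _ ≤ _ := by gcongr
    have hcardZ : (((Z ∪ I.bdry x y S i (I.s i) ρ).card : ℕ) : ℝ) ≤
        Z.card + (I.bdry x y S i (I.s i) ρ).card := by
      exact_mod_cast Finset.card_union_le _ _
    have hsum : ∑ A ∈ insert A C, I.rate γ * I.callBound x A (I.pairsIn T A) ≤
        I.rate γ * I.callBound x A (I.pairsIn T A) +
          ∑ A ∈ C, I.rate γ * I.callBound x A (I.pairsIn T A) := by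
      by_cases hA : A ∈ C
      · rw [Finset.insert_eq_of_mem hA]
        linarith [mul_nonneg ha (callBound_nonneg (U := A) (T := I.pairsIn T A) hx hβ)]
      · rw [Finset.sum_insert hA]
    have hpairs' : ((I.pairsIn T S').card : ℝ) + (I.pairsIn T A).card + 1 ≤
        (I.pairsIn T S).card := by exact_mod_cast hpairs
    -- The volume of a region contains one `β` beyond its `x`-weight; the pair lost in `hpairs'`
    -- compensates for it.
    have hvol : W + I.beta x * (I.pairsIn T A).card +
        (∑ v ∈ S', x v + I.beta x * (I.pairsIn T S').card) ≤
        ∑ v ∈ S, x v + I.beta x * (I.pairsIn T S).card := by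
      rw [regionVol] at hW2
      have := mul_le_mul_of_nonneg_left hpairs' hβ.le
      linarith
    have hmain := mul_le_mul_of_nonneg_left (mul_le_mul_of_nonneg_right hvol hprice) ha
    have hit' := mul_le_mul_of_nonneg_left hit ha
    linarith

theorem Returns.cost_le (h : I.LPFeasible x y) (hk : 2 ≤ I.k) (hγ : 1 < γ)
    (hZ : I.Returns x y γ U T Z) (hβ : 0 < I.beta x) :
    (Z.card : ℝ) ≤ I.rate γ * I.callBound x U T := by
  induction hZ with
  | intro U T S C Z Zrec hloop hdone hrec ih =>
    have hx := h.x_nonneg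
    have ha := rate_nonneg (I := I) hγ
    by_cases hT : T = ∅
    · subst hT
      obtain ⟨rfl, rfl⟩ := hloop.eq_empty (by simp)
      simpa using mul_nonneg ha (callBound_nonneg hx hβ)
    have hcost := hloop.cost_le h hk hγ hβ
    have hS0 := Finset.sum_nonneg fun v (_ : v ∈ S) => hx v
    have hprice := price_nonneg (U := U) (T := T) hx hβ
    have hrest : 0 ≤ I.rate γ *
        ((∑ v ∈ S, x v + I.beta x * (I.pairsIn T S).card) * I.price x U T) := by positivity
    have hcard : (((Z ∪ C.biUnion Zrec).card : ℕ) : ℝ) ≤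
        Z.card + ∑ A ∈ C, ((Zrec A).card : ℝ) := by
      exact_mod_cast (Finset.card_union_le _ _).trans
        (Nat.add_le_add_left Finset.card_biUnion_le _)
    have hsum := Finset.sum_le_sum fun A hA => ih A hA
    rw [callBound, if_neg hT]
    linarith

end Cost

/-! ### Numerical estimates and the final bound -/

theorem exists_log_bound : ∃ c : ℝ, 0 < c ∧ ∀ r : ℕ, 1 ≤ r →
    Real.log (Real.log (Real.exp 1 * ((r : ℝ) + 1))) *
      (1 + Real.log ((r : ℝ) + 1) + 2 * Real.log r) ≤ c * lnTimesLnLn r := by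
  have hlog3 : 1 < Real.log 3 := by
    rw [Real.lt_log_iff_exp_lt (by norm_num)]
    exact Real.exp_one_lt_three
  have hd : 0 < Real.log (Real.log 3) := Real.log_pos hlog3
  -- With `m = max r 3`, the second factor is at most `(1 + 2 + 2) ln m`, and the first at most
  -- `ln(3 ln m) = ln 3 + ln ln m`, where `ln 3` is absorbed using `ln ln m ≥ ln ln 3 > 0`.
  refine ⟨(1 + Real.log 3 / Real.log (Real.log 3)) * 5, by positivity, fun r hr => ?_⟩
  have hr1 : (1 : ℝ) ≤ r := by exact_mod_cast hr
  set m : ℝ := max (r : ℝ) 3 with hm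
  have hm3 : 3 ≤ m := le_max_right _ _
  have hrm : (r : ℝ) ≤ m := le_max_left _ _
  have hlm : Real.log 3 ≤ Real.log m := Real.log_le_log (by norm_num) hm3
  have hlm1 : 1 < Real.log m := hlog3.trans_le hlm
  have hllm : Real.log (Real.log 3) ≤ Real.log (Real.log m) :=
    Real.log_le_log (by linarith) hlm
  have h1 : Real.log ((r : ℝ) + 1) ≤ 2 * Real.log m := by
    rw [show 2 * Real.log m = Real.log (m ^ 2) by rw [Real.log_pow]; norm_num]
    exact Real.log_le_log (by linarith) (by nlinarith)
  have h2 : Real.log r ≤ Real.log m := Real.log_le_log (by linarith) hrm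
  have h3 : Real.log (Real.exp 1 * ((r : ℝ) + 1)) ≤ 3 * Real.log m := by
    rw [Real.log_mul (Real.exp_pos 1).ne' (by linarith), Real.log_exp]
    linarith
  have h4 : Real.log (Real.log (Real.exp 1 * ((r : ℝ) + 1))) ≤
      (1 + Real.log 3 / Real.log (Real.log 3)) * Real.log (Real.log m) := by
    have hpos : 0 < Real.log (Real.exp 1 * ((r : ℝ) + 1)) := by
      rw [Real.log_mul (Real.exp_pos 1).ne' (by linarith), Real.log_exp]
      linarith [Real.log_nonneg (by linarith : (1 : ℝ) ≤ (r : ℝ) + 1)]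
    have h5 := Real.log_le_log hpos h3
    rw [Real.log_mul three_ne_zero (by linarith)] at h5
    have h6 : Real.log 3 ≤ Real.log 3 / Real.log (Real.log 3) * Real.log (Real.log m) := by
      rw [div_mul_eq_mul_div, le_div_iff₀ hd]
      gcongr
    linarith
  have h7 : 0 ≤ Real.log ((r : ℝ) + 1) := Real.log_nonneg (by linarith)
  have h8 := Real.log_nonneg hr1
  rw [lnTimesLnLn, ← hm]
  calc _ ≤ (1 + Real.log 3 / Real.log (Real.log 3)) * Real.log (Real.log m) *
        (5 * Real.log m) :=
        mul_le_mul h4 (by linarith) (by linarith)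
          (mul_nonneg (by positivity) (hd.le.trans hllm))
    _ = _ := by ring

theorem lnTimesLnLn_nonneg (r : ℕ) : 0 ≤ lnTimesLnLn r := by
  have hlog3 : 1 < Real.log 3 := by
    rw [Real.lt_log_iff_exp_lt (by norm_num)]
    exact Real.exp_one_lt_three
  have hlm : 1 ≤ Real.log (max (r : ℝ) 3) :=
    hlog3.le.trans (Real.log_le_log (by norm_num) (le_max_right _ _))
  exact mul_nonneg (by linarith) (Real.log_nonneg hlm)

theorem callBound_univ {V : Type u} {I : NodeMulticut V} [Fintype V] {x : V → ℝ}
    (hβ : 0 < I.beta x) (hr : 0 < I.r) :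
    I.callBound x Finset.univ Finset.univ =
      2 * (∑ v, x v) * (1 + Real.log ((I.r : ℝ) + 1) + 2 * Real.log I.r) := by
  have hr' : (0 : ℝ) < I.r := by exact_mod_cast hr
  have hβr : I.beta x * I.r = ∑ v, x v := div_mul_cancel₀ _ hr'.ne'
  have hne : (Finset.univ : Finset (Fin I.r)) ≠ ∅ :=
    Finset.nonempty_iff_ne_empty.1 ⟨⟨0, hr⟩, Finset.mem_univ _⟩
  have hvol : I.regionVol x Finset.univ = I.beta x * (I.r + 1) := by
    rw [regionVol, ← hβr]
    ring
  rw [callBound, if_neg hne, price, hvol, Real.log_mul hβ.ne' (by positivity), Finset.card_univ,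
    Fintype.card_fin, hβr]
  ring

/-- The potential argument needs `β > 0`. This holds as soon as some pair is well connected in some
region; otherwise no iteration ever takes place and the output is empty. -/
theorem exists_cost_bound : ∃ c : ℝ, 0 < c ∧ ∀ (V : Type u) [Fintype V] [DecidableEq V]
    (I : NodeMulticut V), 2 ≤ I.k → ∀ (x : V → ℝ) (y : Fin I.r → V → ℝ), I.LPFeasible x y →
      ∀ γ : ℝ, 1 < γ → ∀ Z : Finset V, I.Returns x y γ Finset.univ Finset.univ Z →
        (Z.card : ℝ) ≤ c * (γ / (√γ - 1) ^ 2 * lnTimesLnLn I.r) * ∑ v, x v := by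
  obtain ⟨c, hc, hbound⟩ := exists_log_bound
  refine ⟨4 * c, by positivity, fun V _ _ I hk x y h γ hγ Z hZ => ?_⟩
  have hopt : 0 ≤ ∑ v, x v := Finset.sum_nonneg fun v _ => h.x_nonneg v
  have hΛ := lnTimesLnLn_nonneg I.r
  by_cases hconn : ∃ S i, I.ConnAtLeast S (I.s i) (I.t i) (γ * ((I.k : ℝ) - 1))
  · obtain ⟨S, i, hconn⟩ := hconn
    have hβ := beta_pos_of_connAtLeast h hk hγ hconn
    have hcost := hZ.cost_le h hk hγ hβ
    rw [callBound_univ hβ i.pos, rate] at hcost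
    calc (Z.card : ℝ) ≤ _ := hcost
      _ = 4 * (γ / (√γ - 1) ^ 2) * (∑ v, x v) *
          (Real.log (Real.log (Real.exp 1 * ((I.r : ℝ) + 1))) *
            (1 + Real.log ((I.r : ℝ) + 1) + 2 * Real.log I.r)) := by ring
      _ ≤ 4 * (γ / (√γ - 1) ^ 2) * (∑ v, x v) * (c * lnTimesLnLn I.r) := by
          exact mul_le_mul_of_nonneg_left (hbound I.r i.pos) (by positivity)
      _ = _ := by ring
  · have hempty : Z = ∅ := hZ.eq_empty fun S i _ hcon => hconn ⟨S, i, hcon⟩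
    rw [hempty, Finset.card_empty, Nat.cast_zero]
    positivity

/-- Here `γ - 1 = 1/(k-1)`, so `√γ - 1 = 1/((k-1)(√γ+1)) ≥ 1/(3(k-1))`; together with `γ ≤ 2` this
gives `2 · 9 = 18`. -/
theorem gamma_factor_le {k : ℕ} (hk : 2 ≤ k) :
    (k : ℝ) / ((k : ℝ) - 1) / (√((k : ℝ) / ((k : ℝ) - 1)) - 1) ^ 2 ≤ 18 * ((k : ℝ) - 1) ^ 2 := by
  have hk' : (2 : ℝ) ≤ k := by exact_mod_cast hk
  have hk1 : (0 : ℝ) < (k : ℝ) - 1 := by linarith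
  set γ : ℝ := (k : ℝ) / ((k : ℝ) - 1) with hγ
  have hγ2 : γ ≤ 2 := by rw [hγ, div_le_iff₀ hk1]; linarith
  have hγ1 : 1 < γ := by rw [hγ, lt_div_iff₀ hk1]; linarith
  have hdiff : (γ - 1) * ((k : ℝ) - 1) = 1 := by rw [hγ]; field_simp; ring
  have hs1 : 1 < √γ := by rw [Real.lt_sqrt zero_le_one]; linarith
  have hs2 : √γ ≤ 2 := by rw [Real.sqrt_le_left (by norm_num)]; linarith
  have hsq : √γ * √γ = γ := Real.mul_self_sqrt (by linarith)
  have hpos : 0 < √γ - 1 := by linarith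
  rw [div_le_iff₀ (by positivity)]
  have h1 : (√γ - 1) * ((k : ℝ) - 1) * (√γ + 1) = 1 := by
    calc _ = (√γ * √γ - 1) * ((k : ℝ) - 1) := by ring
      _ = 1 := by rw [hsq, hdiff]
  set a := (√γ - 1) * ((k : ℝ) - 1) with ha
  have ha0 : 0 < a := by positivity
  have ha3 : 1 ≤ 3 * a := by nlinarith
  calc γ ≤ 2 * (3 * a) ^ 2 := by nlinarith
    _ = 18 * ((k : ℝ) - 1) ^ 2 * (√γ - 1) ^ 2 := by rw [ha]; ring

end NodeMulticut

theorem theorem5p8 :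
    ∃ C : ℝ, 0 < C ∧
      ∀ (V : Type u) [Fintype V] [DecidableEq V] (I : NodeMulticut V), 2 ≤ I.k →
      ∀ (x : V → ℝ) (y : Fin I.r → V → ℝ), I.LPOptimal x y →
        (∀ γ : ℝ, 1 < γ →
          -- the algorithm never gets stuck, and it has an output
          (∀ (S : Finset V) (i : Fin I.r),
            I.ConnAtLeast S (I.s i) (I.t i) (γ * ((I.k : ℝ) - 1)) →
              ∃ ρ : ℝ, I.GoodRadius x y γ S i ρ) ∧
          (∃ Z : Finset V, I.Returns x y γ Finset.univ Finset.univ Z) ∧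
          -- every output has the claimed cost and connectivity
          ∀ Z : Finset V, I.Returns x y γ Finset.univ Finset.univ Z →
            (Z.card : ℝ) ≤ C * (γ / (√γ - 1) ^ 2 * lnTimesLnLn I.r) * ∑ v, x v ∧
            ∀ i, I.ConnLess (Finset.univ \ Z) (I.s i) (I.t i) (γ * ((I.k : ℝ) - 1))) ∧
        (∀ Z : Finset V,
          I.Returns x y ((I.k : ℝ) / ((I.k : ℝ) - 1)) Finset.univ Finset.univ Z →
            (Z.card : ℝ) ≤ C * (((I.k : ℝ) - 1) ^ 2 * lnTimesLnLn I.r) * ∑ v, x v ∧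
            I.MeetsConnectivity Z ∧
            -- terminals are deleted only if the LP solution puts `y`-weight on them
            (∀ v ∈ Z, I.IsTerminal v → ∃ i, 0 < y i v) ∧
            ((∀ i v, I.IsTerminal v → y i v = 0) → I.IsFeasible Z)) := by
  obtain ⟨c, hc, hcost⟩ := NodeMulticut.exists_cost_bound.{u}
  refine ⟨18 * c, by positivity, fun V _ _ I hk x y hopt => ?_⟩
  have h := hopt.1
  have hsum : 0 ≤ ∑ v, x v := Finset.sum_nonneg fun v _ => h.x_nonneg v
  have hΛ := NodeMulticut.lnTimesLnLn_nonneg I.r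
  refine ⟨fun γ hγ => ⟨fun S i => NodeMulticut.exists_goodRadius h hk hγ,
    NodeMulticut.exists_returns h hk hγ _ _, fun Z hZ => ⟨?_, fun i =>
      hZ.connLess hk hγ i (Finset.mem_univ i)⟩⟩, fun Z hZ => ?_⟩
  · refine (hcost V I hk x y h γ hγ Z hZ).trans ?_
    gcongr
    linarith
  · have hk' : (2 : ℝ) ≤ I.k := by exact_mod_cast hk
    have hk1 : (0 : ℝ) < (I.k : ℝ) - 1 := by linarith
    have hγ : 1 < (I.k : ℝ) / ((I.k : ℝ) - 1) := by rw [lt_div_iff₀ hk1]; linarith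
    have hmeets : I.MeetsConnectivity Z := by
      intro i P hP
      have hlt := hZ.connLess hk hγ i (Finset.mem_univ i) P hP
      -- For this `γ` the threshold `γ(k-1)` is exactly `k`, and fewer than `k` paths means at most
      -- `k - 1`.
      rw [div_mul_cancel₀ _ hk1.ne'] at hlt
      have : P.card < I.k := by exact_mod_cast hlt
      omega
    have hterm := hZ.terminal_pos h
    refine ⟨?_, hmeets, hterm, fun hy => ⟨fun v hv ht => ?_, hmeets⟩⟩
    · refine (hcost V I hk x y h _ hγ Z hZ).trans ?_
      have := NodeMulticut.gamma_factor_le hk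
      calc _ ≤ c * (18 * ((I.k : ℝ) - 1) ^ 2 * lnTimesLnLn I.r) * ∑ v, x v := by gcongr
        _ = _ := by ring
    · obtain ⟨i, hi⟩ := hterm v hv ht
      exact hi.ne' (hy i v ht)
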